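/- Let $G$ be an amenable countable discrete group, let $1<p<\infty$ and $\frac1p+\frac1q=1$. Let $A_p(G)$ be the Herz algebra of $G$: the algebra, under pointwise operations, of all functions $u=\sum_{i=1}^\infty g_i*f_i^\vee$ on $G$ with $f_i\in\ell^p(G)$, $g_i\in\ell^q(G)$ and $\sum_i\|f_i\|_p\|g_i\|_q<\infty$, where $f^\vee(x)=f(x^{-1})$, with norm $\|u\|=\inf\sum_i\|f_i\|_p\|g_i\|_q$ over all such representations of $u$. Let $PM_p(G)$ be the closure of $\ell^1(G)$, acting on $\ell^p(G)$ by left convolution, in the weak operator topology of $B(\ell^p(G))$; an operator $T\in PM_p(G)$ is identified with the functional on $A_p(G)$ determined by $\langle T,\,g*f^\vee\rangle=\sum_{y\in G}(Tf)(y)\,g(y)$. Let $Y_p\subset A_p(G)^*$ be the closed unit ball (for the operator norm) of $PM_p(G)$, let $X_p=\operatorname{span}\{\delta_x: x\in G\}\subset A_p(G)^*$, where $\delta_x(f)=f(x)$, and let $Z_p=X_p\cap Y_p$. A normed algebra $A$ is called Arens regular if the two Arens products on $A^{**}$ coincide. Then the following are equivalent: (i) $A_p(G)$ is Arens regular. (ii)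 For all sequences $(f_n)$, $(g_m)$ in the closed unit ball of $A_p(G)$ and $(\phi_k)$ in $Z_p$, $$\lim_n\lim_m\lim_k\phi_k(f_ng_m)=\lim_m\lim_n\lim_k\phi_k(f_ng_m)$$ whenever both iterated limits exist. (iii) For all sequences $(f_n)$, $(g_m)$ in the closed unit ball of $A_p(G)$ and $(\phi_k)$ in $Z_p$, $$\overline{\{\phi_k(f_ng_m): k>n>m\}}\cap\overline{\{\phi_k(f_ng_m): k>m>n\}}\neq\emptyset .$$ -/

import Mathlib

set_option maxSynthPendingDepth 3

open Filter Topology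

noncomputable section

namespace HerzArens

/-! ### Arens products and Arens regularity -/

/-- The Arens transpose of a bounded bilinear map `B : X × Y → Z`: the bounded bilinear map
`Z* × X → Y*` given by `(T, x) ↦ (y ↦ T (B (x, y)))`. -/
def arensTranspose {X Y Z : Type*}
    [NormedAddCommGroup X] [NormedSpace ℂ X] [NormedAddCommGroup Y] [NormedSpace ℂ Y]
    [NormedAddCommGroup Z] [NormedSpace ℂ Z] (B : X →L[ℂ] Y →L[ℂ] Z) :
    StrongDual ℂ Z →L[ℂ] X →L[ℂ] StrongDual ℂ Y :=
  ((ContinuousLinearMap.compL ℂ X (Y →L[ℂ] Z) (StrongDual ℂ Y)).flip B).comp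
    (ContinuousLinearMap.compL ℂ Y Z ℂ)

theorem arensTranspose_apply {X Y Z : Type*}
    [NormedAddCommGroup X] [NormedSpace ℂ X] [NormedAddCommGroup Y] [NormedSpace ℂ Y]
    [NormedAddCommGroup Z] [NormedSpace ℂ Z] (B : X →L[ℂ] Y →L[ℂ] Z)
    (T : StrongDual ℂ Z) (x : X) (y : Y) : arensTranspose B T x y = T (B x y) := rfl

/-- The first Arens product on `A**`, the third transpose of the multiplication of `A`:
`⟨Ψ □ Φ, T⟩ = ⟨Ψ, u ↦ ⟨Φ, v ↦ T (u v)⟩⟩`. -/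
def firstArensProduct (A : Type*) [NonUnitalNormedRing A] [NormedSpace ℂ A]
    [IsScalarTower ℂ A A] [SMulCommClass ℂ A A] :
    StrongDual ℂ (StrongDual ℂ A) →L[ℂ] StrongDual ℂ (StrongDual ℂ A) →L[ℂ]
      StrongDual ℂ (StrongDual ℂ A) :=
  arensTranspose (arensTranspose (arensTranspose (ContinuousLinearMap.mul ℂ A)))

/-- The second Arens product on `A**`:
`⟨Ψ ◇ Φ, T⟩ = ⟨Φ, v ↦ ⟨Ψ, u ↦ T (u v)⟩⟩`. -/
def secondArensProduct (A : Type*) [NonUnitalNormedRing A] [NormedSpace ℂ A]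
    [IsScalarTower ℂ A A] [SMulCommClass ℂ A A] :
    StrongDual ℂ (StrongDual ℂ A) →L[ℂ] StrongDual ℂ (StrongDual ℂ A) →L[ℂ]
      StrongDual ℂ (StrongDual ℂ A) :=
  (arensTranspose (arensTranspose
    (arensTranspose (ContinuousLinearMap.mul ℂ A).flip))).flip

/-- `A` is Arens regular: the two Arens products on `A**` coincide. -/
def ArensRegular (A : Type*) [NonUnitalNormedRing A] [NormedSpace ℂ A]
    [IsScalarTower ℂ A A] [SMulCommClass ℂ A A] : Prop :=
  ∀ Ψ Φ : StrongDual ℂ (StrongDual ℂ A), firstArensProduct A Ψ Φ = secondArensProduct A Ψ Φ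

/-! ### Amenability -/

/-- A (discrete) group is amenable if there is a left invariant mean on `ℓ^∞(G)`: a positive
normalized linear functional `m` with `m (f (s⁻¹ ·)) = m f` for all `s` and `f`. -/
def IsAmenable (G : Type*) [Group G] : Prop :=
  ∃ m : lp (fun _ : G => ℝ) ⊤ →ₗ[ℝ] ℝ,
    (∀ f : lp (fun _ : G => ℝ) ⊤, (∀ x, 0 ≤ f x) → 0 ≤ m f) ∧
    m 1 = 1 ∧
    ∀ (s : G) (f f' : lp (fun _ : G => ℝ) ⊤), (∀ x, f' x = f (s⁻¹ * x)) → m f' = m f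

/-! ### The spaces `ℓ^r(G)` and convolution -/

/-- `ℓ^r(G)`, the complex `L_r`-space of the discrete group `G` (Haar measure is counting
measure). -/
abbrev ell (G : Type*) (r : ℝ) : Type _ := lp (fun _ : G => ℂ) (ENNReal.ofReal r)

instance factOneLe (p : ℝ) [hp : Fact (1 < p)] : Fact ((1 : ENNReal) ≤ ENNReal.ofReal p) :=
  ⟨by rw [ENNReal.one_le_ofReal]; exact hp.out.le⟩

theorem holder (p : ℝ) [hp : Fact (1 < p)] : p.HolderConjugate p.conjExponent :=
  Real.HolderConjugate.conjExponent hp.out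

instance factConj (p : ℝ) [hp : Fact (1 < p)] : Fact (1 < p.conjExponent) :=
  ⟨(holder p).symm.lt⟩

/-- The convolution `(g * h)(x) = ∑_y g(y) h(y⁻¹x)`. -/
def conv {G : Type*} [Group G] (g h : G → ℂ) : G → ℂ := fun x => ∑' y, g y * h (y⁻¹ * x)

/-- `f^∨(x) = f(x⁻¹)`. -/
def check {G : Type*} [Group G] (f : G → ℂ) : G → ℂ := fun x => f x⁻¹

/-- `u = ∑_i g_i * f_i^∨` with `f_i ∈ ℓ^p(G)`, `g_i ∈ ℓ^q(G)`, `1/p + 1/q = 1` and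
`∑_i ‖f_i‖_p ‖g_i‖_q < ∞`. -/
def IsHerzSum {G : Type*} [Group G] {p : ℝ} [Fact (1 < p)] {ι : Type*} (f : ι → ell G p)
    (g : ι → ell G p.conjExponent) (u : G → ℂ) : Prop :=
  (Summable fun i => ‖f i‖ * ‖g i‖) ∧ ∀ x, u x = ∑' i, conv (g i) (check (f i)) x

/-- `inf ∑_i ‖f_i‖_p ‖g_i‖_q` over all representations `u = ∑_i g_i * f_i^∨`. -/
def herzNorm {G : Type*} [Group G] (p : ℝ) [Fact (1 < p)] (u : G → ℂ) : ℝ :=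
  sInf {r : ℝ | ∃ (f : ℕ → ell G p) (g : ℕ → ell G p.conjExponent),
    IsHerzSum f g u ∧ r = ∑' i, ‖f i‖ * ‖g i‖}

section lemmas

variable {G : Type*} [Group G] {p : ℝ}

theorem toReal_ofReal (p : ℝ) [hp : Fact (1 < p)] : (ENNReal.ofReal p).toReal = p :=
  ENNReal.toReal_ofReal (zero_le_one.trans hp.out.le)

theorem conv_check_apply (f g : G → ℂ) (x : G) :
    conv g (check f) x = ∑' y, g y * f (x⁻¹ * y) := by
  simp [conv, check]

theorem summable_coeff_norm [Fact (1 < p)] (f : ell G p) (g : ell G p.conjExponent) (x : G) :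
    (Summable fun y => ‖g y * f (x⁻¹ * y)‖) ∧
      ∑' y, ‖g y * f (x⁻¹ * y)‖ ≤ ‖f‖ * ‖g‖ := by
  have hq := holder p
  have h0 : 0 < (ENNReal.ofReal p).toReal := by rw [toReal_ofReal]; exact hq.pos
  have h0' : 0 < (ENNReal.ofReal p.conjExponent).toReal := by
    rw [toReal_ofReal]; exact hq.symm.pos
  have hf := lp.hasSum_norm h0 f
  have hg := lp.hasSum_norm h0' g
  rw [toReal_ofReal] at hf hg
  have hf' := (Equiv.mulLeft x⁻¹).hasSum_iff.2 hf
  obtain ⟨C, -, hC', hC⟩ :=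
    Real.inner_le_Lp_mul_Lq_hasSum_of_nonneg hq (norm_nonneg f) (norm_nonneg g)
      (fun i => norm_nonneg (f (Equiv.mulLeft x⁻¹ i))) (fun i => norm_nonneg (g i)) hf' hg
  have e : (fun y => ‖g y * f (x⁻¹ * y)‖)
      = fun y => ‖f (Equiv.mulLeft x⁻¹ y)‖ * ‖g y‖ := by
    funext y; simp [mul_comm]
  rw [e]
  exact ⟨hC.summable, hC.tsum_eq.trans_le hC'⟩

theorem norm_conv_check_le [Fact (1 < p)] (f : ell G p) (g : ell G p.conjExponent) (x : G) :
    ‖conv g (check f) x‖ ≤ ‖f‖ * ‖g‖ := by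
  rw [conv_check_apply]
  have h := summable_coeff_norm f g x
  exact (norm_tsum_le_tsum_norm h.1).trans h.2

theorem IsHerzSum.summable [Fact (1 < p)] {ι : Type*} {f : ι → ell G p}
    {g : ι → ell G p.conjExponent} {u : G → ℂ} (h : IsHerzSum f g u) (x : G) :
    Summable fun i => ‖conv (g i) (check (f i)) x‖ :=
  Summable.of_nonneg_of_le (fun _ => norm_nonneg _) (fun i => norm_conv_check_le _ _ x) h.1

theorem IsHerzSum.norm_apply_le [Fact (1 < p)] {ι : Type*} {f : ι → ell G p}
    {g : ι → ell G p.conjExponent} {u : G → ℂ} (h : IsHerzSum f g u) (x : G) :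
    ‖u x‖ ≤ ∑' i, ‖f i‖ * ‖g i‖ := by
  rw [h.2 x]
  exact (norm_tsum_le_tsum_norm (h.summable x)).trans
    (Summable.tsum_le_tsum (fun i => norm_conv_check_le _ _ x) (h.summable x) h.1)

/-- A representation indexed by a countable type can be reindexed by `ℕ`. -/
theorem IsHerzSum.reindex [Fact (1 < p)] {ι : Type*} [Countable ι] {f : ι → ell G p}
    {g : ι → ell G p.conjExponent} {u : G → ℂ} (h : IsHerzSum f g u) :
    ∃ (f' : ℕ → ell G p) (g' : ℕ → ell G p.conjExponent),
      IsHerzSum f' g' u ∧ ∑' i, ‖f' i‖ * ‖g' i‖ = ∑' i, ‖f i‖ * ‖g i‖ := by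
  obtain ⟨e, he⟩ := exists_injective_nat ι
  have e1 : (fun n => ‖(Function.extend e f 0 : ℕ → ell G p) n‖ * ‖(Function.extend e g 0 : ℕ → ell G p.conjExponent) n‖)
      = Function.extend e (fun i => ‖f i‖ * ‖g i‖) 0 := by
    funext n
    by_cases hn : ∃ i, e i = n
    · obtain ⟨i, rfl⟩ := hn
      simp [he.extend_apply]
    · simp [Function.extend_apply' _ _ _ hn]
  have e2 : ∀ x, (fun n => conv ((Function.extend e g 0 : ℕ → ell G p.conjExponent) n) (check ((Function.extend e f 0 : ℕ → ell G p) n)) x)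
      = Function.extend e (fun i => conv (g i) (check (f i)) x) 0 := by
    intro x
    funext n
    by_cases hn : ∃ i, e i = n
    · obtain ⟨i, rfl⟩ := hn
      simp [he.extend_apply]
    · simp [Function.extend_apply' _ _ _ hn, conv]
  refine ⟨Function.extend e f 0, Function.extend e g 0, ⟨?_, fun x => ?_⟩, ?_⟩
  · rw [e1]
    exact ((hasSum_extend_zero he).2 h.1.hasSum).summable
  · rw [e2, h.2 x]
    exact ((hasSum_extend_zero he).2 (h.summable x).of_norm.hasSum).tsum_eq.symm
  · rw [e1]
    exact ((hasSum_extend_zero he).2 h.1.hasSum).tsum_eq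

theorem herzNorm_nonneg [Fact (1 < p)] (u : G → ℂ) : 0 ≤ herzNorm p u := by
  apply Real.sInf_nonneg
  rintro r ⟨f, g, -, rfl⟩
  exact tsum_nonneg fun _ => mul_nonneg (norm_nonneg _) (norm_nonneg _)

theorem herzNorm_le [Fact (1 < p)] {ι : Type*} [Countable ι] {f : ι → ell G p}
    {g : ι → ell G p.conjExponent} {u : G → ℂ} (h : IsHerzSum f g u) :
    herzNorm p u ≤ ∑' i, ‖f i‖ * ‖g i‖ := by
  obtain ⟨f', g', h', e⟩ := h.reindex
  rw [← e]
  refine csInf_le ⟨0, ?_⟩ ⟨f', g', h', rfl⟩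
  rintro r ⟨f, g, -, rfl⟩
  exact tsum_nonneg fun _ => mul_nonneg (norm_nonneg _) (norm_nonneg _)

theorem exists_isHerzSum_lt [Fact (1 < p)] {u : G → ℂ}
    (hu : ∃ (f : ℕ → ell G p) (g : ℕ → ell G p.conjExponent), IsHerzSum f g u)
    {c : ℝ} (hc : herzNorm p u < c) :
    ∃ (f : ℕ → ell G p) (g : ℕ → ell G p.conjExponent),
      IsHerzSum f g u ∧ ∑' i, ‖f i‖ * ‖g i‖ < c := by
  obtain ⟨f, g, h⟩ := hu
  obtain ⟨r, ⟨f', g', h', rfl⟩, hr⟩ := exists_lt_of_csInf_lt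
    (s := {r : ℝ | ∃ (f : ℕ → ell G p) (g : ℕ → ell G p.conjExponent),
      IsHerzSum f g u ∧ r = ∑' i, ‖f i‖ * ‖g i‖}) ⟨_, f, g, h, rfl⟩ hc
  exact ⟨f', g', h', hr⟩

theorem norm_apply_le_herzNorm [Fact (1 < p)] {u : G → ℂ}
    (hu : ∃ (f : ℕ → ell G p) (g : ℕ → ell G p.conjExponent), IsHerzSum f g u) (x : G) :
    ‖u x‖ ≤ herzNorm p u := by
  refine le_of_forall_gt fun c hc => ?_
  obtain ⟨f, g, h, hlt⟩ := exists_isHerzSum_lt hu hc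
  exact (h.norm_apply_le x).trans_lt hlt

theorem isHerzSum_zero [Fact (1 < p)] : IsHerzSum (G := G) (p := p) (fun e : Empty => e.elim)
    (fun e : Empty => e.elim) 0 :=
  ⟨summable_empty, fun x => by simp⟩

theorem IsHerzSum.add [Fact (1 < p)] {ι κ : Type*} {f : ι → ell G p}
    {g : ι → ell G p.conjExponent} {u : G → ℂ} (h : IsHerzSum f g u) {f' : κ → ell G p}
    {g' : κ → ell G p.conjExponent} {v : G → ℂ} (h' : IsHerzSum f' g' v) :
    IsHerzSum (Sum.elim f f') (Sum.elim g g') (u + v) ∧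
      ∑' i, ‖Sum.elim f f' i‖ * ‖Sum.elim g g' i‖
        = ∑' i, ‖f i‖ * ‖g i‖ + ∑' i, ‖f' i‖ * ‖g' i‖ := by
  have h1 : HasSum (fun i => ‖Sum.elim f f' i‖ * ‖Sum.elim g g' i‖)
      (∑' i, ‖f i‖ * ‖g i‖ + ∑' i, ‖f' i‖ * ‖g' i‖) :=
    HasSum.sum h.1.hasSum h'.1.hasSum
  refine ⟨⟨h1.summable, fun x => ?_⟩, h1.tsum_eq⟩
  have h2 : HasSum (fun i => conv (Sum.elim g g' i : ell G p.conjExponent)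
        (check (Sum.elim f f' i : ell G p)) x)
      (∑' i, conv (g i) (check (f i)) x + ∑' i, conv (g' i) (check (f' i)) x) :=
    HasSum.sum (h.summable x).of_norm.hasSum (h'.summable x).of_norm.hasSum
  rw [h2.tsum_eq, Pi.add_apply, h.2 x, h'.2 x]

theorem IsHerzSum.smul [Fact (1 < p)] {ι : Type*} {f : ι → ell G p}
    {g : ι → ell G p.conjExponent} {u : G → ℂ} (h : IsHerzSum f g u) (c : ℂ) :
    IsHerzSum (fun i => c • f i) g (c • u) ∧
      ∑' i, ‖c • f i‖ * ‖g i‖ = ‖c‖ * ∑' i, ‖f i‖ * ‖g i‖ := by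
  have e : (fun i => ‖c • f i‖ * ‖g i‖) = fun i => ‖c‖ * (‖f i‖ * ‖g i‖) := by
    funext i; rw [norm_smul, mul_assoc]
  refine ⟨⟨?_, fun x => ?_⟩, ?_⟩
  · rw [e]; exact h.1.mul_left _
  · rw [Pi.smul_apply, h.2 x, smul_eq_mul, ← tsum_mul_left]
    congr 1; funext i
    rw [conv_check_apply, conv_check_apply, ← tsum_mul_left]
    congr 1; funext y
    simp only [lp.coeFn_smul, Pi.smul_apply, smul_eq_mul]
    ring
  · rw [e, tsum_mul_left]

/-- The bijection `(w, y) ↦ (y, yw)` of `G × G`. -/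
def shear (G : Type*) [Group G] : G × G ≃ G × G where
  toFun := fun z => (z.2, z.2 * z.1)
  invFun := fun z => (z.1⁻¹ * z.2, z.1)
  left_inv := fun z => by simp
  right_inv := fun z => by simp

theorem hasSum_shear_real {a b : G → ℝ} {s t : ℝ} (ha : HasSum a s) (hb : HasSum b t)
    (ha0 : ∀ y, 0 ≤ a y) (hb0 : ∀ y, 0 ≤ b y) :
    HasSum (fun z : G × G => a z.2 * b (z.2 * z.1)) (s * t) :=
  (shear G).hasSum_iff.2 (ha.mul hb (ha.summable.mul_of_nonneg hb.summable ha0 hb0))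

theorem hasSum_shear {a b : G → ℂ} (ha : Summable fun y => ‖a y‖)
    (hb : Summable fun y => ‖b y‖) :
    HasSum (fun z : G × G => a z.2 * b (z.2 * z.1)) ((∑' y, a y) * ∑' y, b y) :=
  (shear G).hasSum_iff.2
    (ha.of_norm.hasSum.mul hb.of_norm.hasSum (summable_mul_of_summable_norm ha hb))

theorem hasSum_norm_rpow {r : ℝ} [Fact (1 < r)] (a : ell G r) :
    HasSum (fun y => ‖a y‖ ^ r) (‖a‖ ^ r) := by
  have h0 : 0 < (ENNReal.ofReal r).toReal := by
    rw [toReal_ofReal]; exact zero_lt_one.trans Fact.out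
  have ha := lp.hasSum_norm h0 a
  rwa [toReal_ofReal] at ha

/-- The function `y ↦ a(y) b(yw)` in `ℓ^r(G)`, for `a, b ∈ ℓ^r(G)`. -/
def mulShift {r : ℝ} [Fact (1 < r)] (a b : ell G r) (w : G) : ell G r :=
  ⟨fun y => a y * b (y * w), by
    refine memℓp_gen ?_
    rw [toReal_ofReal]
    have h := (hasSum_shear_real (hasSum_norm_rpow a) (hasSum_norm_rpow b)
      (fun y => Real.rpow_nonneg (norm_nonneg _) _)
      (fun y => Real.rpow_nonneg (norm_nonneg _) _)).summable.prod_factor w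
    refine h.congr fun y => ?_
    rw [norm_mul, Real.mul_rpow (norm_nonneg _) (norm_nonneg _)]⟩

theorem mulShift_apply {r : ℝ} [Fact (1 < r)] (a b : ell G r) (w y : G) :
    mulShift a b w y = a y * b (y * w) := rfl

theorem hasSum_norm_mulShift {r : ℝ} [Fact (1 < r)] (a b : ell G r) :
    HasSum (fun w => ‖mulShift a b w‖ ^ r) ((‖a‖ * ‖b‖) ^ r) := by
  rw [Real.mul_rpow (norm_nonneg _) (norm_nonneg _)]
  refine (hasSum_shear_real (hasSum_norm_rpow a) (hasSum_norm_rpow b)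
    (fun y => Real.rpow_nonneg (norm_nonneg _) _)
    (fun y => Real.rpow_nonneg (norm_nonneg _) _)).prod_fiberwise fun w => ?_
  refine (hasSum_norm_rpow (mulShift a b w)).congr_fun fun y => ?_
  rw [mulShift_apply, norm_mul, Real.mul_rpow (norm_nonneg _) (norm_nonneg _)]

theorem mulShift_norms [Fact (1 < p)] (f h : ell G p) (g k : ell G p.conjExponent) :
    (Summable fun w => ‖mulShift f h w‖ * ‖mulShift g k w‖) ∧
      ∑' w, ‖mulShift f h w‖ * ‖mulShift g k w‖ ≤ (‖f‖ * ‖g‖) * (‖h‖ * ‖k‖) := by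
  obtain ⟨C, -, hC', hC⟩ :=
    Real.inner_le_Lp_mul_Lq_hasSum_of_nonneg (holder p)
      (mul_nonneg (norm_nonneg f) (norm_nonneg h)) (mul_nonneg (norm_nonneg g) (norm_nonneg k))
      (fun w => norm_nonneg (mulShift f h w)) (fun w => norm_nonneg (mulShift g k w))
      (hasSum_norm_mulShift f h) (hasSum_norm_mulShift g k)
  refine ⟨hC.summable, ?_⟩
  rw [hC.tsum_eq]
  exact hC'.trans_eq (mul_mul_mul_comm _ _ _ _)

/-- The product of two coefficient functions is a sum of coefficient functions. -/
theorem conv_mul_conv [Fact (1 < p)] (f h : ell G p) (g k : ell G p.conjExponent) (x : G) :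
    conv g (check f) x * conv k (check h) x
      = ∑' w, conv (mulShift g k w) (check (mulShift f h w)) x := by
  have h3 := hasSum_shear (summable_coeff_norm f g x).1 (summable_coeff_norm h k x).1
  rw [conv_check_apply, conv_check_apply]
  refine (HasSum.tsum_eq (h3.prod_fiberwise fun w => ?_)).symm
  rw [conv_check_apply]
  refine (summable_coeff_norm (mulShift f h w) (mulShift g k w) x).1.of_norm.hasSum.congr_fun
    fun y => ?_
  rw [mulShift_apply, mulShift_apply, ← mul_assoc x⁻¹ y w]
  exact mul_mul_mul_comm _ _ _ _

theorem summable_triple {ι κ γ : Type*} {a : ι → ℝ} {b : κ → ℝ} {n : (ι × κ) × γ → ℝ}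
    (ha : Summable a) (hb : Summable b) (ha0 : ∀ i, 0 ≤ a i) (hb0 : ∀ j, 0 ≤ b j)
    (hn0 : ∀ i, 0 ≤ n i)
    (h : ∀ z : ι × κ, (Summable fun w => n (z, w)) ∧ ∑' w, n (z, w) ≤ a z.1 * b z.2) :
    Summable n ∧ ∑' i, n i ≤ (∑' i, a i) * ∑' j, b j := by
  have hprod : Summable fun z : ι × κ => a z.1 * b z.2 := ha.mul_of_nonneg hb ha0 hb0
  have hs1 : Summable fun z : ι × κ => ∑' w, n (z, w) :=
    Summable.of_nonneg_of_le (fun z => tsum_nonneg fun w => hn0 _) (fun z => (h z).2) hprod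
  have hs : Summable n := (summable_prod_of_nonneg hn0).2 ⟨fun z => (h z).1, hs1⟩
  refine ⟨hs, ?_⟩
  rw [hs.tsum_prod, ha.tsum_mul_tsum hb hprod]
  exact Summable.tsum_le_tsum (fun z => (h z).2) hs1 hprod

theorem tsum_mul_tsum_triple {ι κ γ : Type*} {a : ι → ℂ} {b : κ → ℂ} {n : (ι × κ) × γ → ℂ}
    (ha : Summable fun i => ‖a i‖) (hb : Summable fun j => ‖b j‖) (hn : Summable n)
    (h : ∀ z : ι × κ, a z.1 * b z.2 = ∑' w, n (z, w)) :
    (∑' i, a i) * ∑' j, b j = ∑' i, n i := by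
  rw [hn.tsum_prod, tsum_mul_tsum_of_summable_norm ha hb]
  exact tsum_congr h

/-- The representation of `u v` built from representations of `u` and of `v`. -/
theorem IsHerzSum.mul [Fact (1 < p)] {ι κ : Type*} {f : ι → ell G p}
    {g : ι → ell G p.conjExponent} {u : G → ℂ} (h : IsHerzSum f g u) {f' : κ → ell G p}
    {g' : κ → ell G p.conjExponent} {v : G → ℂ} (h' : IsHerzSum f' g' v) :
    ∃ (F : (ι × κ) × G → ell G p) (K : (ι × κ) × G → ell G p.conjExponent),
      IsHerzSum F K (u * v) ∧
      ∑' i, ‖F i‖ * ‖K i‖ ≤ (∑' i, ‖f i‖ * ‖g i‖) * ∑' i, ‖f' i‖ * ‖g' i‖ := by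
  obtain ⟨hs, hle⟩ := summable_triple (a := fun i => ‖f i‖ * ‖g i‖)
    (b := fun j => ‖f' j‖ * ‖g' j‖)
    (n := fun i : (ι × κ) × G =>
      ‖mulShift (f i.1.1) (f' i.1.2) i.2‖ * ‖mulShift (g i.1.1) (g' i.1.2) i.2‖)
    h.1 h'.1 (fun _ => mul_nonneg (norm_nonneg _) (norm_nonneg _))
    (fun _ => mul_nonneg (norm_nonneg _) (norm_nonneg _))
    (fun _ => mul_nonneg (norm_nonneg _) (norm_nonneg _))
    (fun z => mulShift_norms (f z.1) (f' z.2) (g z.1) (g' z.2))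
  refine ⟨fun i => mulShift (f i.1.1) (f' i.1.2) i.2,
    fun i => mulShift (g i.1.1) (g' i.1.2) i.2, ⟨hs, fun x => ?_⟩, hle⟩
  rw [Pi.mul_apply, h.2 x, h'.2 x]
  exact tsum_mul_tsum_triple (h.summable x) (h'.summable x)
    (.of_norm (Summable.of_nonneg_of_le (fun _ => norm_nonneg _)
      (fun i => norm_conv_check_le _ _ x) hs))
    (fun z => conv_mul_conv (f z.1) (f' z.2) (g z.1) (g' z.2) x)

end lemmas

/-! ### The Herz algebra `A_p(G)` -/

/-- The functions `u = ∑_{i} g_i * f_i^∨` form a subalgebra of the algebra of all functions on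
`G` under pointwise operations. -/
def herzSubalgebra (G : Type*) [Group G] [Countable G] (p : ℝ) [Fact (1 < p)] :
    NonUnitalSubalgebra ℂ (G → ℂ) where
  carrier := {u | ∃ (f : ℕ → ell G p) (g : ℕ → ell G p.conjExponent), IsHerzSum f g u}
  zero_mem' := by
    obtain ⟨f, g, h, -⟩ := (isHerzSum_zero (G := G) (p := p)).reindex
    exact ⟨f, g, h⟩
  add_mem' := by
    rintro u v ⟨f, g, h⟩ ⟨f', g', h'⟩
    obtain ⟨F, K, hF, -⟩ := (h.add h').1.reindex
    exact ⟨F, K, hF⟩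
  smul_mem' := by
    rintro c u ⟨f, g, h⟩
    exact ⟨_, _, (h.smul c).1⟩
  mul_mem' := by
    rintro u v ⟨f, g, h⟩ ⟨f', g', h'⟩
    obtain ⟨_, _, hF, -⟩ := h.mul h'
    obtain ⟨F, K, hF, -⟩ := hF.reindex
    exact ⟨F, K, hF⟩

/-- The Herz algebra `A_p(G)` of the countable discrete group `G`: all
`u = ∑_{i=1}^∞ g_i * f_i^∨` with `∑ ‖f_i‖_p ‖g_i‖_q < ∞`, under pointwise operations. -/
def HerzAlgebra (G : Type*) [Group G] [Countable G] (p : ℝ) [Fact (1 < p)] : Type _ :=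
  herzSubalgebra G p

namespace HerzAlgebra

variable {G : Type*} [Group G] [Countable G] {p : ℝ} [Fact (1 < p)]

instance : NonUnitalCommRing (HerzAlgebra G p) :=
  inferInstanceAs (NonUnitalCommRing (herzSubalgebra G p))

instance : Module ℂ (HerzAlgebra G p) := inferInstanceAs (Module ℂ (herzSubalgebra G p))

instance : IsScalarTower ℂ (HerzAlgebra G p) (HerzAlgebra G p) :=
  inferInstanceAs (IsScalarTower ℂ (herzSubalgebra G p) (herzSubalgebra G p))

instance : SMulCommClass ℂ (HerzAlgebra G p) (HerzAlgebra G p) :=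
  inferInstanceAs (SMulCommClass ℂ (herzSubalgebra G p) (herzSubalgebra G p))

instance : CoeFun (HerzAlgebra G p) fun _ => G → ℂ := ⟨Subtype.val⟩

/-- `‖u‖ = inf ∑ ‖f_i‖_p ‖g_i‖_q` over all representations `u = ∑ g_i * f_i^∨`. -/
instance : Norm (HerzAlgebra G p) := ⟨fun u => herzNorm p (u : G → ℂ)⟩

theorem norm_def (u : HerzAlgebra G p) : ‖u‖ = herzNorm p (u : G → ℂ) := rfl

@[simp] theorem add_apply (u v : HerzAlgebra G p) (x : G) : (u + v) x = u x + v x := rfl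

@[simp] theorem mul_apply (u v : HerzAlgebra G p) (x : G) : (u * v) x = u x * v x := rfl

@[simp] theorem smul_apply (c : ℂ) (u : HerzAlgebra G p) (x : G) : (c • u) x = c * u x := rfl

theorem norm_apply_le (u : HerzAlgebra G p) (x : G) : ‖u x‖ ≤ ‖u‖ :=
  norm_apply_le_herzNorm u.2 x

theorem norm_smul_le_aux (c : ℂ) (u : HerzAlgebra G p) : ‖c • u‖ ≤ ‖c‖ * ‖u‖ := by
  refine le_of_forall_pos_lt_add fun ε hε => ?_
  have hlt : herzNorm p u.1 < ‖u‖ + ε / (‖c‖ + 1) := by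
    rw [norm_def]; have : 0 < ε / (‖c‖ + 1) := by positivity
    linarith
  obtain ⟨f, g, h, hlt⟩ := exists_isHerzSum_lt u.2 hlt
  have h1 : ‖c • u‖ ≤ ‖c‖ * ∑' i, ‖f i‖ * ‖g i‖ :=
    (herzNorm_le (h.smul c).1).trans_eq (h.smul c).2
  have h2 : ‖c‖ * ∑' i, ‖f i‖ * ‖g i‖ ≤ ‖c‖ * (‖u‖ + ε / (‖c‖ + 1)) := by gcongr
  have h3 : ‖c‖ * (ε / (‖c‖ + 1)) < ε := by
    rw [← mul_div_assoc, div_lt_iff₀ (by positivity)]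
    nlinarith [norm_nonneg c]
  rw [mul_add] at h2
  linarith

instance : NormedAddCommGroup (HerzAlgebra G p) :=
  AddGroupNorm.toNormedAddCommGroup
    { toFun := fun u => ‖u‖
      map_zero' := le_antisymm
        ((herzNorm_le (isHerzSum_zero (G := G) (p := p))).trans_eq tsum_empty)
        (herzNorm_nonneg _)
      add_le' := fun u v => by
        refine le_of_forall_pos_lt_add fun ε hε => ?_
        obtain ⟨f, g, h, hlt⟩ :=
          exists_isHerzSum_lt u.2 (show herzNorm p u.1 < ‖u‖ + ε / 2 by rw [norm_def]; linarith)
        obtain ⟨f', g', h', hlt'⟩ :=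
          exists_isHerzSum_lt v.2 (show herzNorm p v.1 < ‖v‖ + ε / 2 by rw [norm_def]; linarith)
        have h1 : ‖u + v‖ ≤ _ := (herzNorm_le (h.add h').1).trans_eq (h.add h').2
        linarith
      neg' := fun u => by
        have key : ∀ v : HerzAlgebra G p, ‖-v‖ ≤ ‖v‖ := fun v => by
          have := norm_smul_le_aux (-1 : ℂ) v
          rwa [neg_one_smul, norm_neg, norm_one, one_mul] at this
        refine le_antisymm (key u) ?_
        have := key (-u)
        rwa [neg_neg] at this
      eq_zero_of_map_eq_zero' := fun u hu => by
        refine Subtype.ext (funext fun x => ?_)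
        have h := norm_apply_le u x
        have hu' : ‖u‖ = 0 := hu
        rw [hu'] at h
        exact norm_le_zero_iff.1 h }

/-- `A_p(G)` with pointwise multiplication and the norm above is a commutative normed algebra. -/
instance : NonUnitalNormedCommRing (HerzAlgebra G p) :=
  { (inferInstance : NonUnitalCommRing (HerzAlgebra G p)),
    (inferInstance : NormedAddCommGroup (HerzAlgebra G p)) with
    norm_mul_le := fun u v => by
      have hpos : Tendsto (fun ε : ℝ => (‖u‖ + ε) * (‖v‖ + ε)) (𝓝[>] 0) (𝓝 (‖u‖ * ‖v‖)) := by
        have : Continuous fun ε : ℝ => (‖u‖ + ε) * (‖v‖ + ε) := by fun_prop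
        simpa using (this.tendsto 0).mono_left nhdsWithin_le_nhds
      refine ge_of_tendsto hpos ?_
      filter_upwards [self_mem_nhdsWithin] with ε hε
      have hε : 0 < ε := hε
      obtain ⟨f, g, h, hlt⟩ :=
        exists_isHerzSum_lt u.2 (show herzNorm p u.1 < ‖u‖ + ε by rw [norm_def]; linarith)
      obtain ⟨f', g', h', hlt'⟩ :=
        exists_isHerzSum_lt v.2 (show herzNorm p v.1 < ‖v‖ + ε by rw [norm_def]; linarith)
      obtain ⟨F, K, hF, hle⟩ := h.mul h'
      refine (herzNorm_le hF).trans (hle.trans ?_)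
      have : 0 ≤ ‖u‖ := norm_nonneg u
      exact mul_le_mul hlt.le hlt'.le (tsum_nonneg fun i => by positivity) (by positivity) }

instance : NormedSpace ℂ (HerzAlgebra G p) where
  norm_smul_le := norm_smul_le_aux

/-- The coefficient function `g * f^∨ ∈ A_p(G)` of `f ∈ ℓ^p(G)` and `g ∈ ℓ^q(G)`. -/
def coeff (f : ell G p) (g : ell G p.conjExponent) : HerzAlgebra G p :=
  ⟨conv g (check f), by
    have h : IsHerzSum (fun _ : Unit => f) (fun _ => g) (conv g (check f)) :=
      ⟨(hasSum_fintype _).summable, fun x => by simp⟩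
    obtain ⟨F, K, hF, -⟩ := h.reindex
    exact ⟨F, K, hF⟩⟩

end HerzAlgebra

/-! ### `PM_p(G)` and the sets `X_p`, `Y_p`, `Z_p` -/

/-- The operators on `ℓ^p(G)` of left convolution by an element of `ℓ^1(G)`. -/
def l1ConvolutionOperators (G : Type*) [Group G] (p : ℝ) [Fact (1 < p)] :
    Set (ell G p →L[ℂ] ell G p) :=
  {T | ∃ a : lp (fun _ : G => ℂ) 1, ∀ f : ell G p, ⇑(T f) = conv a f}

/-- `PM_p(G)`: the closure of `ℓ^1(G)`, acting on `ℓ^p(G)` by convolution, in the weak operator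
topology of the bounded operators on `ℓ^p(G)`. -/
def PM (G : Type*) [Group G] (p : ℝ) [Fact (1 < p)] : Set (ell G p →L[ℂ] ell G p) :=
  {T | ContinuousLinearMapWOT.ofCLM T ∈
    closure (ContinuousLinearMapWOT.ofCLM '' l1ConvolutionOperators G p)}

variable (G : Type*) [Group G] [Countable G] (p : ℝ) [Fact (1 < p)]

/-- The operator `T` on `ℓ^p(G)` and the functional `φ` on `A_p(G)` correspond to each other under
the duality `⟨T, g * f^∨⟩ = ⟨T f, g⟩` between `PM_p(G)` and `A_p(G)`. -/
def Represents (T : ell G p →L[ℂ] ell G p) (φ : StrongDual ℂ (HerzAlgebra G p)) : Prop :=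
  ∀ (f : ell G p) (g : ell G p.conjExponent),
    φ (HerzAlgebra.coeff f g) = ∑' y, (T f) y * g y

/-- `Y_p`: the closed unit ball of `PM_p(G)`, viewed in the dual of `A_p(G)`. -/
def Yp : Set (StrongDual ℂ (HerzAlgebra G p)) :=
  {φ | ∃ T ∈ PM G p, ‖T‖ ≤ 1 ∧ Represents G p T φ}

variable {G} in
/-- The evaluation functional `δ_x(u) = u(x)` on `A_p(G)`. -/
def delta (x : G) : StrongDual ℂ (HerzAlgebra G p) :=
  LinearMap.mkContinuous
    { toFun := fun u => u x
      map_add' := fun _ _ => rfl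
      map_smul' := fun _ _ => rfl } 1
    fun u => by rw [one_mul]; exact HerzAlgebra.norm_apply_le u x

/-- `X_p = span {δ_x : x ∈ G}`. -/
def Xp : Submodule ℂ (StrongDual ℂ (HerzAlgebra G p)) :=
  Submodule.span ℂ (Set.range fun x : G => delta p x)

/-- `Z_p = X_p ∩ Y_p`. -/
def Zp : Set (StrongDual ℂ (HerzAlgebra G p)) :=
  (Xp G p : Set (StrongDual ℂ (HerzAlgebra G p))) ∩ Yp G p

end HerzArens

end

/-! If `f n → Ψ` and `g m → Φ` weak-* in the bidual, then at a functional `φ` the first Arens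
product is `lim_n lim_m φ (f n * g m)` and the second is the same limit in the opposite order. Arens
regularity is thus a double limit property, and the theorem says that it can be tested on sequences
and with functionals taken only from `Z_p`.

If `A_p(G)` is regular, take all limits along one nonprincipal ultrafilter. By Alaoglu they exist,
with `φ k` tending to some `ψ` in the dual ball, and the two iterated limits are the two Arens
products at `ψ`. They agree; ordinary limits, when they exist, equal them, and the common value lies
in both closures of (iii).

Conversely, fix `Ψ`, `Φ`, `φ` in the unit balls. Weak-* approximation needs nets in general, but
only countably many functionals matter here, so an inductive use of Goldstine's theorem gives
sequences `f`, `g` realizing both Arens values as iterated limits (`exists_seq_bilinear_approx`). It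
remains to replace `φ` by members of `Z_p`, and this is where amenability enters. Reiter's condition
gives finitely supported `u` in the unit ball forming an approximate unit. The functional `v ↦ φ (u
* v)` is then a finite combination of point evaluations, lies in `Z_p` (`comp_mul_mem_Zp`) and tends
weak-* to `φ`. Condition (ii) now gives equality at once; condition (iii), applied to tails of the
sequences, bounds the difference by arbitrarily small numbers. -/

noncomputable section

namespace HerzArens

/-! ### Ultrafilter limits and Goldstine approximation in dual spaces -/

section Duality

variable {E F : Type*} [NormedAddCommGroup E] [NormedSpace ℂ E]
  [NormedAddCommGroup F] [NormedSpace ℂ F]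

/-- Banach–Alaoglu for sequences: a sequence in the unit ball of the dual converges pointwise
along every ultrafilter. -/
theorem exists_ultrafilter_limit_dual {ι : Type*} (U : Ultrafilter ι) (φ : ι → StrongDual ℂ E)
    (hφ : ∀ k, ‖φ k‖ ≤ 1) :
    ∃ ψ : StrongDual ℂ E, ‖ψ‖ ≤ 1 ∧ ∀ x, Tendsto (fun k => φ k x) U (𝓝 (ψ x)) := by
  have hc := WeakDual.isCompact_closedBall (𝕜 := ℂ) (0 : StrongDual ℂ E) 1
  obtain ⟨ψ, hψ, hle⟩ := hc.ultrafilter_le_nhds (U.map fun k => StrongDual.toWeakDual (φ k))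
    (by
      simp only [Ultrafilter.coe_map, le_principal_iff, mem_map]
      refine Filter.univ_mem' fun k => ?_
      simpa using hφ k)
  refine ⟨WeakDual.toStrongDual ψ, by simpa using hψ, fun x => ?_⟩
  have ht : Tendsto (fun k => StrongDual.toWeakDual (φ k)) U (𝓝 ψ) := hle
  exact ((WeakDual.eval_continuous x).tendsto ψ).comp ht

/-- A bounded sequence converges weak-* in the bidual along every ultrafilter. -/
theorem exists_ultrafilter_limit_bidual {ι : Type*} (U : Ultrafilter ι) (u : ι → E)
    (hu : ∀ k, ‖u k‖ ≤ 1) :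
    ∃ Ψ : StrongDual ℂ (StrongDual ℂ E), ∀ φ : StrongDual ℂ E,
      Tendsto (fun k => φ (u k)) U (𝓝 (Ψ φ)) := by
  obtain ⟨Ψ, -, h⟩ := exists_ultrafilter_limit_dual U
    (fun k => NormedSpace.inclusionInDoubleDual ℂ E (u k))
    (fun k => (NormedSpace.double_dual_bound ℂ E (u k)).trans (hu k))
  exact ⟨Ψ, fun φ => by simpa using h φ⟩

/-- Multiplying `u` by a unimodular scalar makes `ℓ u` real and nonnegative, so real parts already
see the norm. -/
theorem norm_le_of_re_le {ℓ : StrongDual ℂ E} {t : ℝ} (h : ∀ u, ‖u‖ ≤ 1 → (ℓ u).re ≤ t) :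
    ‖ℓ‖ ≤ t := by
  have ht : 0 ≤ t := by simpa using h 0 (by simp)
  refine ContinuousLinearMap.opNorm_le_of_unit_norm (𝕜 := ℂ) ht fun u hu => ?_
  obtain ⟨c, hc, hcu⟩ := RCLike.exists_norm_eq_mul_self (ℓ u)
  have := h (c • u) (by rw [norm_smul, hc, hu, one_mul])
  rw [map_smul, smul_eq_mul, ← hcu] at this
  simpa using this

/-- Goldstine's theorem: on finitely many functionals an element of the unit ball of the bidual
is approximated by elements of the unit ball. -/
theorem exists_goldstine_approx {Ψ : StrongDual ℂ (StrongDual ℂ E)} (hΨ : ‖Ψ‖ ≤ 1)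
    (S : Finset (StrongDual ℂ E)) {ε : ℝ} (hε : 0 < ε) :
    ∃ u : E, ‖u‖ ≤ 1 ∧ ∀ ℓ ∈ S, ‖ℓ u - Ψ ℓ‖ < ε := by
  classical
  set L : E →ₗ[ℂ] (S → ℂ) := LinearMap.pi fun ℓ => (ℓ.1 : E →ₗ[ℂ] ℂ) with hL
  set x : S → ℂ := fun ℓ => Ψ ℓ.1 with hx
  set C : Set (S → ℂ) := closure (L '' Metric.closedBall 0 1) with hC
  have hconv : Convex ℝ C := by
    refine Convex.closure ?_
    have := (convex_closedBall (0 : E) 1).linear_image (L.restrictScalars ℝ)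
    simpa using this
  have hmem : x ∈ C := by
    by_contra hx'
    -- A functional separating `x` from the image of the ball is, after composition with `L`, a
    -- combination `ℓ₀` of the members of `S`. Then `‖ℓ₀‖ ≤ t < re (Ψ ℓ₀) ≤ ‖ℓ₀‖`, which is absurd.
    obtain ⟨f, t, hft, htx⟩ := RCLike.geometric_hahn_banach_closed_point (𝕜 := ℂ) hconv
      isClosed_closure hx'
    set ℓ₀ : StrongDual ℂ E := ∑ ℓ : S, f (Pi.single ℓ 1) • ℓ.1 with hℓ₀
    have hf : ∀ v : S → ℂ, f v = ∑ ℓ : S, f (Pi.single ℓ 1) * v ℓ := fun v => by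
      conv_lhs => rw [pi_eq_sum_univ' v, map_sum]
      refine Finset.sum_congr rfl fun ℓ _ => ?_
      rw [map_smul, smul_eq_mul, mul_comm]
    have h1 : ∀ u, f (L u) = ℓ₀ u := fun u => by
      rw [hf, hℓ₀]; simp [hL]
    have h2 : f x = Ψ ℓ₀ := by
      rw [hf, hℓ₀, map_sum]; simp [hx]
    have h3 : ‖ℓ₀‖ ≤ t := norm_le_of_re_le fun u hu => by
      have := hft (L u) (subset_closure ⟨u, by simpa using hu, rfl⟩)
      rw [h1] at this
      exact this.le
    have h4 : (Ψ ℓ₀).re ≤ ‖ℓ₀‖ :=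
      (Complex.re_le_norm _).trans ((Ψ.le_of_opNorm_le hΨ ℓ₀).trans_eq (one_mul _))
    rw [h2] at htx
    exact absurd htx (not_lt.2 (h4.trans h3))
  obtain ⟨_, ⟨u, hu, rfl⟩, hd⟩ := Metric.mem_closure_iff.1 hmem ε hε
  refine ⟨u, by simpa using hu, fun ℓ hℓ => ?_⟩
  have := (dist_pi_lt_iff hε).1 hd ⟨ℓ, hℓ⟩
  rwa [dist_comm, dist_eq_norm] at this

/-- Simultaneous approximation of two elements `Ψ`, `Φ` of bidual unit balls by sequences `f`, `g`
whose iterated limits under a bilinear form `B` are `Ψ (Φ ∘ B)` and `Φ (Ψ ∘ Bᵗ)`. -/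
theorem exists_seq_bilinear_approx (B : E →L[ℂ] F →L[ℂ] ℂ)
    {Ψ : StrongDual ℂ (StrongDual ℂ E)} (hΨ : ‖Ψ‖ ≤ 1)
    {Φ : StrongDual ℂ (StrongDual ℂ F)} (hΦ : ‖Φ‖ ≤ 1) :
    ∃ (f : ℕ → E) (g : ℕ → F), (∀ n, ‖f n‖ ≤ 1) ∧ (∀ n, ‖g n‖ ≤ 1) ∧
      (∀ n : ℕ, ‖Φ (B (f n)) - Ψ (Φ.comp B)‖ ≤ 1 / ((n : ℝ) + 1)) ∧
      (∀ m : ℕ, ‖Ψ (B.flip (g m)) - Φ (Ψ.comp B.flip)‖ ≤ 1 / ((m : ℝ) + 1)) ∧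
      (∀ n m : ℕ, n < m → ‖B (f n) (g m) - Φ (B (f n))‖ ≤ 1 / ((m : ℝ) + 1)) ∧
      ∀ n m : ℕ, m < n → ‖B (f n) (g m) - Ψ (B.flip (g m))‖ ≤ 1 / ((n : ℝ) + 1) := by
  classical
  let δ : ℕ → ℝ := fun n => 1 / ((n : ℝ) + 1)
  have hδ : ∀ n, 0 < δ n := fun n => Nat.one_div_pos_of_nat
  obtain ⟨s, hP, hr⟩ := exists_seq_of_forall_finset_exists
    (fun x : ℕ × E × F => ‖x.2.1‖ ≤ 1 ∧ ‖x.2.2‖ ≤ 1 ∧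
      ‖Φ (B x.2.1) - Ψ (Φ.comp B)‖ ≤ δ x.1 ∧
      ‖Ψ (B.flip x.2.2) - Φ (Ψ.comp B.flip)‖ ≤ δ x.1)
    (fun x y : ℕ × E × F => x.1 < y.1 ∧ ‖B x.2.1 y.2.2 - Φ (B x.2.1)‖ ≤ δ y.1 ∧
      ‖B y.2.1 x.2.2 - Ψ (B.flip x.2.2)‖ ≤ δ y.1) (by
    intro T _
    -- Each triple carries its own stage number, so that the tolerance `δ N` shrinks along the
    -- construction. The new `u` must match `Ψ` on the functionals of all earlier `v`'s, and vice
    -- versa; pairs of equal stage are left uncontrolled.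
    set N := T.sup Prod.fst + 1 with hN
    obtain ⟨u, hu, hu'⟩ := exists_goldstine_approx hΨ
      (insert (Φ.comp B) (T.image fun x => B.flip x.2.2)) (hδ N)
    obtain ⟨v, hv, hv'⟩ := exists_goldstine_approx hΦ
      (insert (Ψ.comp B.flip) (T.image fun x => B x.2.1)) (hδ N)
    refine ⟨(N, u, v), ⟨hu, hv, (hu' _ (Finset.mem_insert_self _ _)).le,
      (hv' _ (Finset.mem_insert_self _ _)).le⟩, fun x hx => ⟨?_, ?_, ?_⟩⟩
    · exact Nat.lt_succ_of_le (Finset.le_sup (f := Prod.fst) hx)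
    · exact (hv' _ (Finset.mem_insert_of_mem (Finset.mem_image_of_mem _ hx))).le
    · exact (hu' _ (Finset.mem_insert_of_mem (Finset.mem_image_of_mem
        (fun x : ℕ × E × F => B.flip x.2.2) hx))).le)
  have hmono : StrictMono fun n => (s n).1 := fun m n h => (hr m n h).1
  have hle : ∀ n, δ (s n).1 ≤ δ n := fun n => Nat.one_div_le_one_div (hmono.id_le n)
  exact ⟨fun n => (s n).2.1, fun n => (s n).2.2, fun n => (hP n).1, fun n => (hP n).2.1,
    fun n => (hP n).2.2.1.trans (hle n), fun n => (hP n).2.2.2.trans (hle n),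
    fun n m h => (hr n m h).2.1.trans (hle m), fun n m h => (hr m n h).2.2.trans (hle n)⟩

end Duality

/-! ### Amenability and Reiter's condition -/

section Reiter

variable {G : Type*}

theorem memℓp_top_of_bound {F : G → ℝ} {C : ℝ} (hF : ∀ y, |F y| ≤ C) :
    Memℓp (E := fun _ : G => ℝ) F ⊤ :=
  memℓp_infty ⟨C, by rintro _ ⟨y, rfl⟩; exact hF y⟩

theorem norm_lp_one_eq_tsum (v : lp (fun _ : G => ℝ) 1) : ‖v‖ = ∑' y, |v y| := by
  rw [lp.norm_eq_tsum_rpow (by simp)]; simp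

/-- Reiter's condition `P₁`, with finitely supported functions. -/
theorem IsAmenable.exists_reiter [Group G] (hG : IsAmenable G) (K : Finset G) {ε : ℝ} (hε : 0 < ε) :
    ∃ h : G →₀ ℝ, (∀ y, 0 ≤ h y) ∧ ∑' y, h y = 1 ∧
      ∀ x ∈ K, ∑' y, |h (x⁻¹ * y) - h y| < ε := by
  classical
  let e : G → lp (fun _ : G => ℝ) 1 := fun y => lp.single 1 y 1
  let d : G → K → lp (fun _ : G => ℝ) 1 := fun y x => e (x * y) - e y
  let D := Finsupp.linearCombination ℝ d
  let S : Set (G →₀ ℝ) := {h | (∀ y, 0 ≤ h y) ∧ h.sum (fun _ a => a) = 1}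
  have hS : Convex ℝ S := by
    rintro h ⟨h0, h1⟩ k ⟨k0, k1⟩ a b ha hb hab
    refine ⟨fun y => ?_, ?_⟩
    · simp only [Finsupp.add_apply, Finsupp.smul_apply, smul_eq_mul]
      exact add_nonneg (mul_nonneg ha (h0 y)) (mul_nonneg hb (k0 y))
    · rw [Finsupp.sum_add_index' (by simp) (by simp), Finsupp.sum_smul_index (by simp),
        Finsupp.sum_smul_index (by simp), ← Finsupp.mul_sum, ← Finsupp.mul_sum, h1, k1,
        mul_one, mul_one, hab]
  have hD : ∀ (h : G →₀ ℝ) (x : K) (y : G), D h x y = h ((x : G)⁻¹ * y) - h y := by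
    intro h x y
    induction h using Finsupp.induction_linear with
    | zero => simp
    | add h k hh hk =>
      rw [map_add, Pi.add_apply, lp.coeFn_add, Pi.add_apply, hh, hk]
      simp only [Finsupp.add_apply]; ring
    | single z a =>
      have e1 : (x : G)⁻¹ * y = z ↔ y = x * z := inv_mul_eq_iff_eq_mul
      simp only [D, Finsupp.linearCombination_single, Pi.smul_apply, lp.coeFn_smul, d, e,
        lp.coeFn_sub, Pi.sub_apply, lp.single_apply, Finsupp.single_apply, Pi.single_apply,
        smul_eq_mul, eq_comm (a := z), e1]
      split_ifs <;> simp
  -- Day's convexity argument: `D h` collects the differences of the translates of `h` by `K` with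
  -- `h`, and the claim is that probability vectors `h` make it arbitrarily small in norm. Otherwise
  -- Hahn–Banach gives `f` with `f (d y) > u > 0` for all `y`.
  have key : (0 : K → lp (fun _ : G => ℝ) 1) ∈ closure (D '' S) := by
    by_contra h0
    obtain ⟨f, u, hu0, hu⟩ := geometric_hahn_banach_point_closed
      (hS.linear_image D).closure isClosed_closure h0
    rw [map_zero] at hu0
    have hd : ∀ y, u < f (d y) := fun y => hu _ (subset_closure ⟨Finsupp.single y 1,
      ⟨fun z => by rw [Finsupp.single_apply]; split_ifs <;> simp, by simp⟩, by simp [D]⟩)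
    -- The coordinates of `f` are bounded functions on `G`, and `f (d y)` is a sum of differences
    -- between their translates and themselves. An invariant mean sends it to `0`, yet positivity
    -- forces at least `u`.
    let Φ : K → G → ℝ := fun x y => f (Pi.single x (e y))
    have hΦ : ∀ x y, |Φ x y| ≤ ‖f‖ := fun x y => by
      refine (f.le_opNorm _).trans ?_
      rw [Pi.norm_single, lp.norm_single (by simp)]
      simp
    have hfd : ∀ y, f (d y) = ∑ x : K, (Φ x (x * y) - Φ x y) := fun y => by
      conv_lhs => rw [← Finset.univ_sum_single (d y), map_sum]
      refine Finset.sum_congr rfl fun x _ => ?_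
      rw [← map_sub, ← Pi.single_sub]
    obtain ⟨m, hm0, hm1, hm⟩ := hG
    let P : K → lp (fun _ : G => ℝ) ⊤ := fun x => ⟨Φ x, memℓp_top_of_bound (hΦ x)⟩
    let Q : K → lp (fun _ : G => ℝ) ⊤ := fun x =>
      ⟨fun y => Φ x (x * y), memℓp_top_of_bound fun y => hΦ x _⟩
    have hPQ : ∀ x, m (Q x) = m (P x) := fun x =>
      hm (x : G)⁻¹ (P x) (Q x) fun y => by rw [inv_inv]
    have hpos := hm0 ((∑ x : K, (Q x - P x)) - u • 1) fun y => by
      have h1 : (((∑ x : K, (Q x - P x)) - u • 1 : lp (fun _ : G => ℝ) ⊤) : G → ℝ) y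
          = f (d y) - u := by
        rw [hfd]
        simp only [lp.coeFn_sub, lp.coeFn_sum, lp.coeFn_smul, Pi.sub_apply, Finset.sum_apply,
          Pi.smul_apply, smul_eq_mul, lp.infty_coeFn_one, Pi.one_apply, mul_one]
        rfl
      rw [h1]
      exact (sub_pos.2 (hd y)).le
    rw [map_sub, map_sum, map_smul, hm1, smul_eq_mul, mul_one,
      Finset.sum_eq_zero fun x _ => by rw [map_sub, hPQ, sub_self]] at hpos
    linarith
  obtain ⟨_, ⟨h, ⟨h0, h1⟩, rfl⟩, hlt⟩ := Metric.mem_closure_iff.1 key ε hε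
  refine ⟨h, h0, ?_, fun x hx => ?_⟩
  · rw [← h1, Finsupp.sum, tsum_eq_sum]
    intro y hy
    simpa using hy
  · rw [dist_zero_left] at hlt
    have h2 := (norm_le_pi_norm (D h) ⟨x, hx⟩).trans_lt hlt
    rw [norm_lp_one_eq_tsum] at h2
    simpa only [hD] using h2

/-- Superadditivity of `t ↦ t ^ p` on `[0, ∞)`, applied to `a ^ p⁻¹ - b ^ p⁻¹` and `b ^ p⁻¹`. It
transfers Reiter's condition from `ℓ^1` to `ℓ^p`. -/
theorem abs_rpow_inv_sub_rpow_le {p a b : ℝ} (hp : 1 < p) (ha : 0 ≤ a) (hb : 0 ≤ b) :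
    |a ^ p⁻¹ - b ^ p⁻¹| ^ p ≤ |a - b| := by
  wlog hab : b ≤ a generalizing a b
  · rw [abs_sub_comm, abs_sub_comm a]
    exact this hb ha (not_le.1 hab).le
  have hp0 : p ≠ 0 := by positivity
  have h1 : b ^ p⁻¹ ≤ a ^ p⁻¹ := Real.rpow_le_rpow hb hab (by positivity)
  have h2 := Real.add_rpow_le_rpow_add (sub_nonneg.2 h1) (Real.rpow_nonneg hb p⁻¹) hp.le
  rw [sub_add_cancel, Real.rpow_inv_rpow hb hp0, Real.rpow_inv_rpow ha hp0] at h2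
  rw [abs_of_nonneg (sub_nonneg.2 h1), abs_of_nonneg (sub_nonneg.2 hab)]
  linarith

end Reiter

/-! ### Left translation and duality on `ℓ^r(G)` -/

section Translation

variable {G : Type*} [Group G] {r : ℝ} [Fact (1 < r)]

theorem norm_le_of_hasSum_rpow {f : ell G r} {s C : ℝ} (h : HasSum (fun y => ‖f y‖ ^ r) s)
    (hC : 0 ≤ C) (hs : s ≤ C ^ r) : ‖f‖ ≤ C := by
  have hr : 0 < r := zero_lt_one.trans Fact.out
  rw [← Real.rpow_le_rpow_iff (norm_nonneg f) hC hr, (hasSum_norm_rpow f).unique h]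
  exact hs

/-- Left translation `(λ_x f)(y) = f(x⁻¹y)` on `ℓ^r(G)`. -/
def leftShift (x : G) : ell G r →L[ℂ] ell G r :=
  LinearMap.mkContinuous
    { toFun := fun f => ⟨fun y => f (x⁻¹ * y), memℓp_gen (by
        rw [toReal_ofReal]
        exact ((Equiv.mulLeft x⁻¹).hasSum_iff.2 (hasSum_norm_rpow f)).summable)⟩
      map_add' := fun _ _ => rfl
      map_smul' := fun _ _ => rfl } 1 fun f => by
    rw [one_mul]
    exact norm_le_of_hasSum_rpow ((Equiv.mulLeft x⁻¹).hasSum_iff.2 (hasSum_norm_rpow f))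
      (norm_nonneg f) le_rfl

@[simp] theorem leftShift_apply (x : G) (f : ell G r) (y : G) :
    leftShift x f y = f (x⁻¹ * y) := rfl

/-- The norm of `h ∈ ℓ^p(G)` is determined by its pairing with `ℓ^q(G)`. -/
theorem norm_le_of_pairing_le {p : ℝ} [Fact (1 < p)] (h : ell G p) {C : ℝ}
    (hC : ∀ g : ell G p.conjExponent, ‖∑' y, h y * g y‖ ≤ C * ‖g‖) : ‖h‖ ≤ C := by
  have hpq := holder p
  set q := p.conjExponent with hq
  have hp0 : p ≠ 0 := hpq.ne_zero
  have hs := hasSum_norm_rpow h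
  -- The extremal function in Hölder's inequality is `conj h · |h| ^ (p - 2)`; since `(p - 1) q =
  -- p`, its `q`-th power has modulus `|h| ^ p`.
  have hg : ∀ y, ‖(starRingEnd ℂ (h y) * ((‖h y‖ ^ (p - 2) : ℝ) : ℂ))‖ ^ q = ‖h y‖ ^ p := by
    intro y
    rcases eq_or_ne (h y) 0 with h0 | h0
    · simp [h0, Real.zero_rpow hp0, Real.zero_rpow hpq.symm.ne_zero]
    have h1 : 0 < ‖h y‖ := norm_pos_iff.2 h0
    rw [norm_mul, RCLike.norm_conj, Complex.norm_real, Real.norm_of_nonneg (by positivity)]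
    nth_rewrite 1 [← Real.rpow_one ‖h y‖]
    rw [← Real.rpow_add h1, ← Real.rpow_mul h1.le]
    congr 1
    rw [← add_sub_assoc, add_comm, add_sub_assoc]
    convert hpq.sub_one_mul_conj using 2
    ring
  let g : ell G q := ⟨fun y => starRingEnd ℂ (h y) * ((‖h y‖ ^ (p - 2) : ℝ) : ℂ), memℓp_gen (by
    rw [toReal_ofReal]
    exact hs.summable.congr fun y => (hg y).symm)⟩
  have hgn : ‖g‖ ^ q = ‖h‖ ^ p :=
    (hasSum_norm_rpow g).unique (hs.congr_fun fun y => hg y)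
  have hsum : ∑' y, h y * g y = ((‖h‖ ^ p : ℝ) : ℂ) := by
    rw [← (Complex.hasSum_ofReal.2 hs).tsum_eq]
    refine tsum_congr fun y => ?_
    change h y * (starRingEnd ℂ (h y) * ((‖h y‖ ^ (p - 2) : ℝ) : ℂ)) = _
    rcases eq_or_ne (h y) 0 with h0 | h0
    · simp [h0, Real.zero_rpow hp0]
    have h1 : 0 < ‖h y‖ := norm_pos_iff.2 h0
    rw [← mul_assoc, Complex.mul_conj, Complex.normSq_eq_norm_sq, ← Complex.ofReal_mul,
      ← Real.rpow_natCast, ← Real.rpow_add h1]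
    congr 2; norm_num
  have hmain := hC g
  rw [hsum, Complex.norm_real, Real.norm_of_nonneg (by positivity)] at hmain
  -- For `h = 0` the claim is `0 ≤ C`, which needs a nonzero test function.
  rcases eq_or_ne h 0 with rfl | h0
  · classical
    have := hC (lp.single _ 1 1)
    rw [lp.norm_single (ENNReal.ofReal_pos.2 hpq.symm.pos)] at this
    simpa using this
  have hh : 0 < ‖h‖ := norm_pos_iff.2 h0
  have hgn' : ‖g‖ = ‖h‖ ^ (p - 1) := by
    rw [← Real.rpow_rpow_inv (norm_nonneg g) hpq.symm.ne_zero, hgn, ← Real.rpow_mul hh.le,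
      ← hpq.div_conj_eq_sub_one, div_eq_mul_inv]
  rw [hgn'] at hmain
  have : ‖h‖ ^ p = ‖h‖ * ‖h‖ ^ (p - 1) := by
    rw [← Real.rpow_one_add' hh.le (by simpa using hp0)]
    congr 1; ring
  rw [this] at hmain
  exact le_of_mul_le_mul_right hmain (by positivity)

end Translation

/-! ### Norm convergence and finitely supported elements in `A_p(G)` -/

namespace HerzAlgebra

variable {G : Type*} [Group G] [Countable G] {p : ℝ} [Fact (1 < p)]

theorem delta_apply (x : G) (u : HerzAlgebra G p) : delta p x u = u x := rfl

@[ext] theorem ext {u v : HerzAlgebra G p} (h : ∀ x, u x = v x) : u = v :=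
  Subtype.ext (funext h)

theorem sum_apply {ι : Type*} (s : Finset ι) (u : ι → HerzAlgebra G p) (x : G) :
    (∑ i ∈ s, u i : HerzAlgebra G p) x = ∑ i ∈ s, u i x :=
  map_sum (delta p x) u s

theorem coeff_apply (f : ell G p) (g : ell G p.conjExponent) (x : G) :
    coeff f g x = ∑' y, g y * f (x⁻¹ * y) := conv_check_apply _ _ x

theorem norm_coeff_le (f : ell G p) (g : ell G p.conjExponent) : ‖coeff f g‖ ≤ ‖f‖ * ‖g‖ := by
  have h : IsHerzSum (fun _ : Unit => f) (fun _ => g) (coeff f g : G → ℂ) :=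
    ⟨(hasSum_fintype _).summable, fun x => by simp [coeff]⟩
  rw [norm_def]
  simpa using herzNorm_le h

variable (G p) in
/-- The bounded bilinear map `(f, g) ↦ g * f^∨` from `ℓ^p(G) × ℓ^q(G)` to `A_p(G)`. -/
def coeffL : ell G p →L[ℂ] ell G p.conjExponent →L[ℂ] HerzAlgebra G p :=
  LinearMap.mkContinuous₂ (LinearMap.mk₂ ℂ coeff
    (fun f f' g => ext fun x => by
      rw [add_apply, coeff_apply, coeff_apply, coeff_apply,
        ← (summable_coeff_norm f g x).1.of_norm.tsum_add (summable_coeff_norm f' g x).1.of_norm]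
      exact tsum_congr fun y => mul_add _ _ _)
    (fun c f g => ext fun x => by
      rw [smul_apply, coeff_apply, coeff_apply, ← tsum_mul_left]
      exact tsum_congr fun y => mul_left_comm _ _ _)
    (fun f g g' => ext fun x => by
      rw [add_apply, coeff_apply, coeff_apply, coeff_apply,
        ← (summable_coeff_norm f g x).1.of_norm.tsum_add (summable_coeff_norm f g' x).1.of_norm]
      exact tsum_congr fun y => add_mul _ _ _)
    (fun c f g => ext fun x => by
      rw [smul_apply, coeff_apply, coeff_apply, ← tsum_mul_left]
      exact tsum_congr fun y => mul_assoc _ _ _)) 1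
    fun f g => by rw [one_mul]; exact norm_coeff_le f g

theorem coeffL_apply (f : ell G p) (g : ell G p.conjExponent) : coeffL G p f g = coeff f g := rfl

/-- A representation `u = ∑ g_i * f_i^∨` converges in the norm of `A_p(G)`. -/
theorem hasSum_coeff {ι : Type*} [Countable ι] {f : ι → ell G p} {g : ι → ell G p.conjExponent}
    {u : HerzAlgebra G p} (h : IsHerzSum f g (u : G → ℂ)) :
    HasSum (fun i => coeff (f i) (g i)) u := by
  rw [HasSum, tendsto_iff_norm_sub_tendsto_zero]
  refine squeeze_zero (fun _ => norm_nonneg _) (fun s => ?_)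
    (tendsto_tsum_compl_atTop_zero fun i => ‖f i‖ * ‖g i‖)
  rw [norm_sub_rev]
  -- The omitted terms represent the remainder, so its norm is at most the tail of `∑ ‖f i‖ * ‖g
  -- i‖`.
  refine herzNorm_le (f := fun i : {i // i ∉ s} => f i) (g := fun i => g i)
    ⟨h.1.subtype _, fun x => ?_⟩
  have h1 := (h.summable x).of_norm.sum_add_tsum_subtype_compl s
  rw [← h.2 x] at h1
  change (u - ∑ i ∈ s, coeff (f i) (g i) : HerzAlgebra G p) x = _
  rw [← delta_apply, map_sub, delta_apply, delta_apply, sum_apply, sub_eq_iff_eq_add', ← h1]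
  rfl

theorem coeff_single_right [DecidableEq G] (f : ell G p) (b : G) (t : ℂ) (x : G) :
    coeff f (lp.single _ b t) x = t * f (x⁻¹ * b) := by
  rw [coeff_apply, tsum_eq_single b, lp.single_apply_self]
  intro y hy
  rw [lp.single_apply_ne _ _ _ hy, zero_mul]

variable (p) in
/-- The indicator function of `{x}` as an element of `A_p(G)`. -/
def ind [DecidableEq G] (x : G) : HerzAlgebra G p :=
  coeff (lp.single _ 1 1) (lp.single _ x 1)

theorem ind_apply [DecidableEq G] (x z : G) : ind p x z = if z = x then 1 else 0 := by
  have h : z⁻¹ * x = 1 ↔ z = x := by rw [inv_mul_eq_one]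
  rw [ind, coeff_single_right, one_mul, lp.single_apply, Pi.single_apply, if_congr h rfl rfl]

theorem coeff_single_single [DecidableEq G] (a b : G) (s t : ℂ) :
    coeff (p := p) (lp.single _ a s) (lp.single _ b t) = (t * s) • ind p (b * a⁻¹) := by
  ext z
  have h : z⁻¹ * b = a ↔ z = b * a⁻¹ := by
    rw [inv_mul_eq_iff_eq_mul, eq_mul_inv_iff_mul_eq, eq_comm]
  rw [coeff_single_right, smul_apply, ind_apply, lp.single_apply, Pi.single_apply,
    if_congr h rfl rfl]
  split_ifs <;> simp

/-- The indicator functions of points span a dense subspace of `A_p(G)`. -/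
theorem eq_top_of_isClosed_of_ind_mem [DecidableEq G] (V : Submodule ℂ (HerzAlgebra G p))
    (hV : IsClosed (V : Set (HerzAlgebra G p))) (h : ∀ x, ind p x ∈ V) : V = ⊤ := by
  have hmem : ∀ {ι : Type _} {a : ι → HerzAlgebra G p} {u : HerzAlgebra G p},
      HasSum a u → (∀ i, a i ∈ V) → u ∈ V := fun ha hi =>
    hV.mem_of_tendsto ha (Eventually.of_forall fun s => V.sum_mem fun i _ => hi i)
  -- Expand `f`, then `g`, into point masses: the coefficient function of two point masses is a
  -- multiple of an indicator.
  have h1 : ∀ (f : ell G p) (b : G) (t : ℂ), coeff f (lp.single _ b t) ∈ V := fun f b t => by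
    have := (lp.hasSum_single ENNReal.ofReal_ne_top f).mapL ((coeffL G p).flip (lp.single _ b t))
    refine hmem this fun i => ?_
    change coeff _ _ ∈ V
    rw [coeff_single_single]
    exact V.smul_mem _ (h _)
  have h2 : ∀ (f : ell G p) (g : ell G p.conjExponent), coeff f g ∈ V := fun f g =>
    hmem ((lp.hasSum_single ENNReal.ofReal_ne_top g).mapL (coeffL G p f)) fun i => h1 f i (g i)
  refine eq_top_iff.2 fun u _ => ?_
  obtain ⟨f, g, hfg⟩ := u.2
  have := hasSum_coeff hfg
  exact hV.mem_of_tendsto this (Eventually.of_forall fun s => V.sum_mem fun i _ => h2 _ _)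

theorem mul_eq_sum_ind [DecidableEq G] {u : HerzAlgebra G p} {s : Finset G}
    (hu : ∀ x ∉ s, u x = 0) (v : HerzAlgebra G p) :
    u * v = ∑ x ∈ s, (u x * v x) • ind p x := by
  ext z
  simp only [mul_apply, sum_apply, smul_apply, ind_apply, mul_ite, mul_one, mul_zero,
    Finset.sum_ite_eq]
  split_ifs with hz
  · rfl
  · rw [hu z hz, zero_mul]

/-! ### Approximate units -/

/-- If `u_i` is bounded by `1` and converges to `1` pointwise then it is an approximate unit. -/
theorem tendsto_mul_of_tendsto_apply {ι : Type*} {l : Filter ι} {u : ι → HerzAlgebra G p}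
    (hu : ∀ i, ‖u i‖ ≤ 1) (h1 : ∀ x, Tendsto (fun i => u i x) l (𝓝 1)) (w : HerzAlgebra G p) :
    Tendsto (fun i => u i * w) l (𝓝 w) := by
  classical
  -- The uniform bound on `u i` makes this subspace closed, and it contains the indicators because
  -- `u i * ind p x = u i x • ind p x`.
  let V : Submodule ℂ (HerzAlgebra G p) :=
    { carrier := {w | Tendsto (fun i => u i * w) l (𝓝 w)}
      zero_mem' := by
        simp only [Set.mem_ofPred_eq, mul_zero]; exact tendsto_const_nhds
      add_mem' := fun {a b} ha hb => by
        simp only [Set.mem_ofPred_eq, mul_add]; exact Tendsto.add ha hb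
      smul_mem' := fun c a ha => by
        simp only [Set.mem_ofPred_eq, mul_smul_comm]; exact Tendsto.const_smul ha c }
  suffices hV : V = ⊤ by
    have : w ∈ V := hV ▸ Submodule.mem_top
    exact this
  refine eq_top_of_isClosed_of_ind_mem V (closure_subset_iff_isClosed.1 fun w hw => ?_) fun x => ?_
  · refine Metric.tendsto_nhds.2 fun ε hε => ?_
    obtain ⟨w₀, hw₀, hd⟩ := Metric.mem_closure_iff.1 hw (ε / 3) (by positivity)
    filter_upwards [Metric.tendsto_nhds.1 hw₀ (ε / 3) (by positivity)] with i hi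
    have h3 : dist (u i * w) (u i * w₀) ≤ dist w w₀ := by
      rw [dist_eq_norm, dist_eq_norm, ← mul_sub]
      exact (norm_mul_le _ _).trans (mul_le_of_le_one_left (norm_nonneg _) (hu i))
    have h4 := dist_triangle4 (u i * w) (u i * w₀) w₀ w
    rw [dist_comm w₀ w] at h4
    linarith
  · have : ∀ i, u i * ind p x = u i x • ind p x := fun i => by
      ext z
      rw [mul_apply, smul_apply, ind_apply]
      split_ifs with hz
      · rw [hz]
      · simp
    change Tendsto (fun i => u i * ind p x) l (𝓝 (ind p x))
    simp_rw [this]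
    simpa using (h1 x).smul_const (ind p x)

end HerzAlgebra

/-! ### Finitely supported approximate units from Reiter functions -/

section ApproximateUnit

variable {G : Type*} {r : ℝ} [Fact (1 < r)]

theorem summable_abs_finsupp (h : G →₀ ℝ) : Summable fun y => |h y| :=
  summable_of_hasFiniteSupport (h.hasFiniteSupport.subset fun y hy => by simpa using hy)

theorem norm_root_rpow (r : ℝ) [hr : Fact (1 < r)] (t : ℝ) :
    ‖((|t| ^ r⁻¹ : ℝ) : ℂ)‖ ^ r = |t| := by
  rw [Complex.norm_real, Real.norm_of_nonneg (by positivity),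
    Real.rpow_inv_rpow (abs_nonneg t) (zero_lt_one.trans hr.out).ne']

variable (r) in
/-- The function `|h|^{1/r} ∈ ℓ^r(G)` for finitely supported `h`. -/
def lpRoot (h : G →₀ ℝ) : ell G r :=
  ⟨fun y => ((|h y| ^ r⁻¹ : ℝ) : ℂ), memℓp_gen (by
    rw [toReal_ofReal]
    exact (summable_abs_finsupp h).congr fun y => (norm_root_rpow r (h y)).symm)⟩

theorem lpRoot_apply (h : G →₀ ℝ) (y : G) : lpRoot r h y = ((|h y| ^ r⁻¹ : ℝ) : ℂ) := rfl

theorem norm_lpRoot_le [Group G] {h : G →₀ ℝ} (h1 : ∑' y, |h y| ≤ 1) : ‖lpRoot r h‖ ≤ 1 :=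
  norm_le_of_hasSum_rpow ((summable_abs_finsupp h).hasSum.congr_fun fun y => norm_root_rpow r (h y))
    zero_le_one (by rwa [Real.one_rpow])

/-- The root inequality `abs_rpow_inv_sub_rpow_le`, summed over `y`, turns almost invariance in
`ℓ^1` into almost invariance in `ℓ^r`. -/
theorem norm_leftShift_lpRoot_sub_lt [Group G] {h : G →₀ ℝ} (x : G) {ε : ℝ} (hε : 0 < ε)
    (hx : ∑' y, |h (x⁻¹ * y) - h y| < ε ^ r) : ‖leftShift x (lpRoot r h) - lpRoot r h‖ < ε := by
  have hr : 1 < r := Fact.out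
  rw [← Real.rpow_lt_rpow_iff (norm_nonneg _) hε.le (zero_lt_one.trans hr)]
  have hs := hasSum_norm_rpow (leftShift x (lpRoot r h) - lpRoot r h)
  have hle : ∀ y, ‖(leftShift x (lpRoot r h) - lpRoot r h) y‖ ^ r ≤ |h (x⁻¹ * y) - h y| := by
    intro y
    rw [lp.coeFn_sub, Pi.sub_apply, leftShift_apply, lpRoot_apply, lpRoot_apply,
      ← Complex.ofReal_sub, Complex.norm_real, Real.norm_eq_abs]
    exact (abs_rpow_inv_sub_rpow_le hr (abs_nonneg _) (abs_nonneg _)).trans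
      (abs_abs_sub_abs_le _ _)
  have hsum : Summable fun y => |h (x⁻¹ * y) - h y| := by
    refine Summable.of_nonneg_of_le (fun _ => abs_nonneg _) (fun y => abs_sub _ _)
      (((Equiv.mulLeft x⁻¹).summable_iff.2 (summable_abs_finsupp h)).add (summable_abs_finsupp h))
  exact (hasSum_le hle hs hsum.hasSum).trans_lt hx

/-- For a Reiter function `h`, take the coefficient of `h ^ (1/p)` and `h ^ (1/q)`. Its value at `1`
is `∑ h = 1`, and almost invariance of `h ^ (1/p)` keeps it near `1` on `K`. -/
theorem HerzAlgebra.exists_approx_one [Group G] [Countable G] (hG : IsAmenable G) (p : ℝ)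
    [Fact (1 < p)] (K : Finset G) {ε : ℝ} (hε : 0 < ε) :
    ∃ u : HerzAlgebra G p, ‖u‖ ≤ 1 ∧ (∃ s : Finset G, ∀ x ∉ s, u x = 0) ∧
      ∀ x ∈ K, ‖u x - 1‖ < ε := by
  classical
  have hpq := holder p
  obtain ⟨h, h0, h1, hK⟩ := hG.exists_reiter K (Real.rpow_pos_of_pos hε p)
  have h1' : ∑' y, |h y| = 1 := by simpa only [abs_of_nonneg (h0 _)] using h1
  set f := lpRoot p h with hf
  set g := lpRoot p.conjExponent h with hg
  have hfn : ‖f‖ ≤ 1 := norm_lpRoot_le h1'.le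
  have hgn : ‖g‖ ≤ 1 := norm_lpRoot_le h1'.le
  have hg0 : ∀ y ∉ h.support, g y = 0 := fun y hy => by
    rw [hg, lpRoot_apply, Finsupp.notMem_support_iff.1 hy, abs_zero,
      Real.zero_rpow hpq.symm.inv_ne_zero, Complex.ofReal_zero]
  have hf0 : ∀ y ∉ h.support, f y = 0 := fun y hy => by
    rw [hf, lpRoot_apply, Finsupp.notMem_support_iff.1 hy, abs_zero,
      Real.zero_rpow hpq.inv_ne_zero, Complex.ofReal_zero]
  refine ⟨coeff f g, (norm_coeff_le f g).trans (mul_le_one₀ hfn (norm_nonneg _) hgn),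
    ⟨(h.support ×ˢ h.support).image fun z => z.1 * z.2⁻¹, fun x hx => ?_⟩, fun x hx => ?_⟩
  · rw [coeff_apply]
    refine (tsum_congr fun y => ?_).trans tsum_zero
    by_cases hy : y ∈ h.support
    · rw [hf0 (x⁻¹ * y), mul_zero]
      intro hxy
      refine hx (Finset.mem_image.2 ⟨(y, x⁻¹ * y), Finset.mem_product.2 ⟨hy, hxy⟩, ?_⟩)
      group
    · rw [hg0 y hy, zero_mul]
  · have hone : coeff f g 1 = 1 := by
      rw [coeff_apply, ← Complex.ofReal_one, ← h1', Complex.ofReal_tsum]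
      refine tsum_congr fun y => ?_
      rw [inv_one, one_mul, hf, hg, lpRoot_apply, lpRoot_apply, ← Complex.ofReal_mul,
        ← Real.rpow_add' (abs_nonneg _) (by rw [add_comm, hpq.inv_add_inv_eq_one]; simp), add_comm,
        hpq.inv_add_inv_eq_one, Real.rpow_one]
    -- Evaluation at `x` is evaluation at `1` after translating `f`, so the error is at most
    -- `‖leftShift x f - f‖ * ‖g‖`.
    have hsub : coeff f g x - 1 = coeff (leftShift x f - f) g 1 := by
      conv_lhs => rw [← hone]
      have e : coeff f g x = coeff (leftShift x f) g 1 := by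
        rw [coeff_apply, coeff_apply]
        exact tsum_congr fun y => by rw [leftShift_apply, inv_one, one_mul]
      rw [e]
      simp only [← coeffL_apply, ← delta_apply, map_sub, _root_.sub_apply]
    rw [hsub]
    refine (norm_apply_le _ _).trans_lt ((norm_coeff_le _ _).trans_lt ?_)
    exact (mul_le_of_le_one_right (norm_nonneg _) hgn).trans_lt
      (norm_leftShift_lpRoot_sub_lt x hε (hK x hx))

/-- For amenable `G` the algebra `A_p(G)` has an approximate unit of finitely supported functions
in its unit ball. -/
theorem HerzAlgebra.exists_approximate_unit [Group G] [Countable G] (hG : IsAmenable G) (p : ℝ)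
    [Fact (1 < p)] :
    ∃ u : Finset G × ℕ → HerzAlgebra G p, (∀ i, ‖u i‖ ≤ 1) ∧
      (∀ i, ∃ s : Finset G, ∀ x ∉ s, u i x = 0) ∧
      ∀ w, Tendsto (fun i => u i * w) atTop (𝓝 w) := by
  classical
  choose u hu hs h1 using fun i : Finset G × ℕ =>
    exists_approx_one hG p i.1 (Nat.one_div_pos_of_nat (α := ℝ) (n := i.2))
  refine ⟨u, hu, hs, tendsto_mul_of_tendsto_apply hu fun x => ?_⟩
  rw [tendsto_iff_norm_sub_tendsto_zero]
  refine squeeze_zero' (Eventually.of_forall fun _ => norm_nonneg _) ?_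
    (tendsto_one_div_add_atTop_nhds_zero_nat.comp
      (tendsto_snd.mono_left (prod_atTop_atTop_eq (α := Finset G) (β := ℕ)).ge))
  filter_upwards [eventually_ge_atTop (({x}, 0) : Finset G × ℕ)] with i hi
  exact (h1 i x (hi.1 (Finset.mem_singleton_self x))).le

end ApproximateUnit

/-! ### The sets `Y_p` and `Z_p` -/

section Zp

variable {G : Type*} [Group G] [Countable G] {p : ℝ} [Fact (1 < p)]

open HerzAlgebra

/-- On a coefficient, `φ` is evaluation at `1` of the coefficient of `T f` and `g`, hence at most
`‖f‖ * ‖g‖`; sum over nearly optimal representations. -/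
theorem norm_le_one_of_mem_Yp {φ : StrongDual ℂ (HerzAlgebra G p)} (hφ : φ ∈ Yp G p) :
    ‖φ‖ ≤ 1 := by
  obtain ⟨T, -, hT, hTφ⟩ := hφ
  refine φ.opNorm_le_bound zero_le_one fun u => ?_
  rw [one_mul]
  refine le_of_forall_gt fun c hc => ?_
  obtain ⟨f, g, h, hlt⟩ := exists_isHerzSum_lt u.2 hc
  refine lt_of_le_of_lt ?_ hlt
  rw [← ((hasSum_coeff h).mapL φ).tsum_eq]
  refine tsum_of_norm_bounded h.1.hasSum fun i => ?_
  have e : φ (coeff (f i) (g i)) = coeff (T (f i)) (g i) 1 := by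
    rw [hTφ, coeff_apply]
    exact tsum_congr fun y => by rw [inv_one, one_mul, mul_comm]
  rw [e]
  refine (norm_apply_le _ _).trans ((norm_coeff_le _ _).trans ?_)
  gcongr
  simpa using T.le_of_opNorm_le hT (f i)

theorem hasSum_leftShift_mul (f : ell G p) (g : ell G p.conjExponent) (x : G) :
    HasSum (fun y => leftShift x f y * g y) (coeff f g x) := by
  rw [coeff_apply]
  refine (summable_coeff_norm f g x).1.of_norm.hasSum.congr_fun fun y => ?_
  rw [leftShift_apply, mul_comm]

/-- Combinations of point evaluations of norm at most `1` belong to `Z_p`. -/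
theorem sum_delta_mem_Zp (s : Finset G) (c : G → ℂ)
    (hc : ‖∑ x ∈ s, c x • (delta p x : StrongDual ℂ (HerzAlgebra G p))‖ ≤ 1) :
    ∑ x ∈ s, c x • delta p x ∈ Zp G p := by
  classical
  set φ : StrongDual ℂ (HerzAlgebra G p) := ∑ x ∈ s, c x • delta p x with hφ
  let T : ell G p →L[ℂ] ell G p := ∑ x ∈ s, c x • leftShift x
  have hT : ∀ (f : ell G p) (y : G), T f y = ∑ x ∈ s, c x * f (x⁻¹ * y) := fun f y => by
    simp only [T, _root_.sum_apply, _root_.smul_apply, lp.coeFn_sum,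
      Finset.sum_apply, lp.coeFn_smul, Pi.smul_apply, smul_eq_mul, leftShift_apply]
  have hTφ : Represents G p T φ := fun f g => by
    have h1 : HasSum (fun y => T f y * g y) (∑ x ∈ s, c x * coeff f g x) := by
      refine (hasSum_sum fun x _ => (hasSum_leftShift_mul f g x).mul_left (c x)).congr_fun
        fun y => ?_
      rw [hT, Finset.sum_mul]
      exact Finset.sum_congr rfl fun x _ => mul_assoc _ _ _
    rw [h1.tsum_eq, hφ, _root_.sum_apply]
    rfl
  refine ⟨Submodule.sum_mem _ fun x _ => Submodule.smul_mem _ _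
    (Submodule.subset_span ⟨x, rfl⟩), T, ?_, ?_, hTφ⟩
  -- No closure is needed: `T` is convolution by the finitely supported function with values `c x`
  -- on `s`.
  · refine subset_closure ⟨T, ⟨∑ x ∈ s, c x • lp.single 1 x 1, fun f => funext fun y => ?_⟩, rfl⟩
    have ha : ∀ z, (∑ x ∈ s, c x • lp.single 1 x (1 : ℂ) : lp (fun _ : G => ℂ) 1) z
        = if z ∈ s then c z else 0 := fun z => by
      rw [lp.coeFn_sum, Finset.sum_apply]
      simp only [lp.coeFn_smul, Pi.smul_apply, lp.single_apply, Pi.single_apply, smul_eq_mul,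
        mul_ite, mul_one, mul_zero, Finset.sum_ite_eq]
    rw [hT, conv, tsum_eq_sum (s := s)]
    · exact Finset.sum_congr rfl fun x hx => by rw [ha, if_pos hx]
    · intro z hz
      rw [ha, if_neg hz, zero_mul]
  -- The bound is known for the functional; duality between `ℓ^p` and `ℓ^q` passes it to the
  -- operator.
  · refine T.opNorm_le_bound zero_le_one fun f => ?_
    rw [one_mul]
    refine norm_le_of_pairing_le _ fun g => ?_
    rw [← hTφ f g]
    exact (φ.le_of_opNorm_le hc _).trans (by rw [one_mul]; exact norm_coeff_le f g)

/-- Finite support gives `u * v = ∑ u x v x • ind p x`, so the functional is the combination of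
point evaluations with coefficients `u x * φ (ind p x)`. Submultiplicativity keeps its norm at most
`1`. -/
theorem comp_mul_mem_Zp {φ : StrongDual ℂ (HerzAlgebra G p)} (hφ : ‖φ‖ ≤ 1)
    {u : HerzAlgebra G p} (hu : ‖u‖ ≤ 1) (hs : ∃ s : Finset G, ∀ x ∉ s, u x = 0) :
    φ.comp (ContinuousLinearMap.mul ℂ (HerzAlgebra G p) u) ∈ Zp G p := by
  classical
  obtain ⟨s, hs⟩ := hs
  have e : φ.comp (ContinuousLinearMap.mul ℂ (HerzAlgebra G p) u)
      = ∑ x ∈ s, (u x * φ (ind p x)) • delta p x := by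
    ext v
    rw [ContinuousLinearMap.comp_apply, ContinuousLinearMap.mul_apply', mul_eq_sum_ind hs,
      map_sum, _root_.sum_apply]
    refine Finset.sum_congr rfl fun x _ => ?_
    rw [map_smul, _root_.smul_apply, delta_apply, smul_eq_mul, smul_eq_mul]
    ring
  rw [e]
  refine sum_delta_mem_Zp s _ ?_
  rw [← e]
  refine (φ.opNorm_comp_le _).trans (mul_le_one₀ hφ (norm_nonneg _) ?_)
  exact (ContinuousLinearMap.opNorm_mul_apply_le ℂ _ u).trans hu

/-- For amenable `G`, `Z_p` is weak-* dense in the unit ball of `A_p(G)*`. -/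
theorem exists_mem_Zp_approx (hG : IsAmenable G) {φ : StrongDual ℂ (HerzAlgebra G p)}
    (hφ : ‖φ‖ ≤ 1) (W : Finset (HerzAlgebra G p)) {ε : ℝ} (hε : 0 < ε) :
    ∃ ψ ∈ Zp G p, ∀ w ∈ W, ‖ψ w - φ w‖ < ε := by
  classical
  obtain ⟨u, hu, hs, h1⟩ := exists_approximate_unit hG p
  have h2 : ∀ᶠ i in atTop, ∀ w ∈ W, ‖φ (u i * w) - φ w‖ < ε :=
    (Filter.eventually_all_finset W).2 fun w _ => by
      have := Metric.tendsto_nhds.1 ((φ.continuous.tendsto w).comp (h1 w)) ε hε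
      simpa [dist_eq_norm] using this
  obtain ⟨i, hi⟩ := h2.exists
  exact ⟨_, comp_mul_mem_Zp hφ (hu i) (hs i), hi⟩

end Zp

/-! ### The iterated limit criteria -/

section IteratedLimits

variable {G : Type*} [Group G] [Countable G] {p : ℝ} [Fact (1 < p)]

/-- It suffices to compare the Arens products on elements of norm at most `1`. -/
theorem arensRegular_of_norm_le_one {A : Type*} [NonUnitalNormedRing A] [NormedSpace ℂ A]
    [IsScalarTower ℂ A A] [SMulCommClass ℂ A A]
    (h : ∀ (Ψ Φ : StrongDual ℂ (StrongDual ℂ A)) (φ : StrongDual ℂ A), ‖Ψ‖ ≤ 1 → ‖Φ‖ ≤ 1 →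
      ‖φ‖ ≤ 1 → firstArensProduct A Ψ Φ φ = secondArensProduct A Ψ Φ φ) : ArensRegular A := by
  have hs : ∀ {E : Type _} [NormedAddCommGroup E] [NormedSpace ℂ E] (x : E),
      ∃ (c : ℂ) (y : E), ‖y‖ ≤ 1 ∧ x = c • y := fun x => by
    rcases eq_or_ne x 0 with rfl | hx
    · exact ⟨0, 0, by simp, by simp⟩
    · have hx' : (‖x‖ : ℂ) ≠ 0 := by simpa using hx
      refine ⟨‖x‖, (‖x‖ : ℂ)⁻¹ • x, ?_, (smul_inv_smul₀ hx' x).symm⟩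
      rw [norm_smul, norm_inv, Complex.norm_real, norm_norm,
        inv_mul_cancel₀ (norm_ne_zero_iff.2 hx)]
  intro Ψ Φ
  ext φ
  obtain ⟨a, Ψ, hΨ, rfl⟩ := hs Ψ
  obtain ⟨b, Φ, hΦ, rfl⟩ := hs Φ
  obtain ⟨c, φ, hφ, rfl⟩ := hs φ
  simp only [map_smul, _root_.smul_apply, h Ψ Φ φ hΨ hΦ hφ]

/-- In an Arens regular algebra, iterated limits along an ultrafilter can be interchanged. -/
theorem ArensRegular.exists_iterated_limit {A : Type*} [NonUnitalNormedRing A] [NormedSpace ℂ A]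
    [IsScalarTower ℂ A A] [SMulCommClass ℂ A A] (hA : ArensRegular A) (U : Ultrafilter ℕ)
    {f g : ℕ → A} {φ : ℕ → StrongDual ℂ A} (hf : ∀ n, ‖f n‖ ≤ 1) (hg : ∀ n, ‖g n‖ ≤ 1)
    (hφ : ∀ k, ‖φ k‖ ≤ 1) :
    ∃ (c : ℕ → ℕ → ℂ) (r s : ℕ → ℂ) (a : ℂ),
      (∀ n m, Tendsto (fun k => φ k (f n * g m)) U (𝓝 (c n m))) ∧
      (∀ n, Tendsto (fun m => c n m) U (𝓝 (r n))) ∧ Tendsto r U (𝓝 a) ∧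
      (∀ m, Tendsto (fun n => c n m) U (𝓝 (s m))) ∧ Tendsto s U (𝓝 a) := by
  obtain ⟨ψ, -, hψ⟩ := exists_ultrafilter_limit_dual U φ hφ
  obtain ⟨Ψ, hΨ⟩ := exists_ultrafilter_limit_bidual U f hf
  obtain ⟨Φ, hΦ⟩ := exists_ultrafilter_limit_bidual U g hg
  -- With `B u v = ψ (u * v)`, the Arens products at `ψ` are by definition `Ψ (Φ.comp B)` and `Φ
  -- (Ψ.comp B.flip)`, the two iterated limits.
  let B := arensTranspose (ContinuousLinearMap.mul ℂ A) ψ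
  refine ⟨fun n m => ψ (f n * g m), fun n => Φ (B (f n)), fun m => Ψ (B.flip (g m)),
    firstArensProduct A Ψ Φ ψ, fun n m => hψ _, fun n => hΦ (B (f n)), hΨ (Φ.comp B),
    fun m => hΨ (B.flip (g m)), ?_⟩
  rw [hA Ψ Φ]
  exact hΦ (Ψ.comp B.flip)

/-- Sequences in `A_p(G)` and `Z_p` approximating the values of the two Arens products. -/
theorem exists_seq_approx_arensProducts (hG : IsAmenable G)
    {Ψ Φ : StrongDual ℂ (StrongDual ℂ (HerzAlgebra G p))} {φ : StrongDual ℂ (HerzAlgebra G p)}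
    (hΨ : ‖Ψ‖ ≤ 1) (hΦ : ‖Φ‖ ≤ 1) (hφ : ‖φ‖ ≤ 1) :
    ∃ (f g : ℕ → HerzAlgebra G p) (φ' : ℕ → StrongDual ℂ (HerzAlgebra G p)) (r s : ℕ → ℂ),
      (∀ n, ‖f n‖ ≤ 1) ∧ (∀ m, ‖g m‖ ≤ 1) ∧ (∀ k, φ' k ∈ Zp G p) ∧
      (∀ k n m : ℕ, n < k → m < k →
        ‖φ' k (f n * g m) - φ (f n * g m)‖ ≤ 1 / ((k : ℝ) + 1)) ∧
      (∀ n : ℕ, ‖r n - firstArensProduct _ Ψ Φ φ‖ ≤ 1 / ((n : ℝ) + 1)) ∧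
      (∀ m : ℕ, ‖s m - secondArensProduct _ Ψ Φ φ‖ ≤ 1 / ((m : ℝ) + 1)) ∧
      (∀ n m : ℕ, n < m → ‖φ (f n * g m) - r n‖ ≤ 1 / ((m : ℝ) + 1)) ∧
      ∀ n m : ℕ, m < n → ‖φ (f n * g m) - s m‖ ≤ 1 / ((n : ℝ) + 1) := by
  classical
  obtain ⟨f, g, hf, hg, h1, h2, h3, h4⟩ :=
    exists_seq_bilinear_approx (arensTranspose (ContinuousLinearMap.mul ℂ _) φ) hΨ hΦ
  -- The `k`-th functional need only agree with `φ` up to `1 / (k + 1)` on the finitely many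
  -- products of index below `k`.
  choose φ' hZ happ using fun k : ℕ => exists_mem_Zp_approx hG hφ
    ((Finset.range k ×ˢ Finset.range k).image fun z => f z.1 * g z.2)
    (Nat.one_div_pos_of_nat (α := ℝ) (n := k))
  refine ⟨f, g, φ', _, _, hf, hg, hZ, fun k n m hn hm => (happ k _ ?_).le, h1, h2, h3, h4⟩
  exact Finset.mem_image.2 ⟨(n, m), Finset.mem_product.2
    ⟨Finset.mem_range.2 hn, Finset.mem_range.2 hm⟩, rfl⟩

theorem tendsto_of_norm_sub_le_one_div {E : Type*} [NormedAddCommGroup E] {x : ℕ → E} {a : E}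
    {N : ℕ} (h : ∀ n, N < n → ‖x n - a‖ ≤ 1 / ((n : ℝ) + 1)) : Tendsto x atTop (𝓝 a) := by
  rw [tendsto_iff_norm_sub_tendsto_zero]
  refine squeeze_zero' (Eventually.of_forall fun _ => norm_nonneg _) ?_
    tendsto_one_div_add_atTop_nhds_zero_nat
  filter_upwards [eventually_gt_atTop N] with n hn using h n hn

/-- Since `l ≤ atTop`, each inner variable eventually exceeds the outer ones, so every successive
limit stays in the closed set `closure S`. -/
theorem mem_closure_of_iterated_limit {X : Type*} [TopologicalSpace X] {l : Filter ℕ} [l.NeBot]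
    (hl : l ≤ atTop) {x : ℕ → ℕ → ℕ → X} {c : ℕ → ℕ → X} {r : ℕ → X} {a : X} {S : Set X}
    (hc : ∀ n m, Tendsto (fun k => x n m k) l (𝓝 (c n m)))
    (hr : ∀ n, Tendsto (fun m => c n m) l (𝓝 (r n))) (ha : Tendsto r l (𝓝 a))
    (hS : ∀ n m k, n < m → m < k → x n m k ∈ S) : a ∈ closure S := by
  have h1 : ∀ n m, n < m → c n m ∈ closure S := fun n m hnm =>
    mem_closure_of_tendsto (hc n m)
      (((eventually_gt_atTop m).filter_mono hl).mono fun k hk => hS n m k hnm hk)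
  have h2 : ∀ n, r n ∈ closure S := fun n =>
    isClosed_closure.mem_of_tendsto (hr n)
      (((eventually_gt_atTop n).filter_mono hl).mono fun m hm => h1 n m hm)
  exact isClosed_closure.mem_of_tendsto ha (Eventually.of_forall h2)

theorem norm_sub_le_of_three {E : Type*} [SeminormedAddCommGroup E] {w x y z : E} {k m n N : ℕ}
    (hk : N ≤ k) (hm : N ≤ m) (hn : N ≤ n) (h1 : ‖w - x‖ ≤ 1 / ((k : ℝ) + 1))
    (h2 : ‖x - y‖ ≤ 1 / ((m : ℝ) + 1)) (h3 : ‖y - z‖ ≤ 1 / ((n : ℝ) + 1)) :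
    ‖w - z‖ ≤ 3 * (1 / ((N : ℝ) + 1)) := by
  have e : w - z = (w - x) + (x - y) + (y - z) := by abel
  rw [e]
  refine norm_add₃_le.trans ?_
  have := h1.trans (Nat.one_div_le_one_div hk)
  have := h2.trans (Nat.one_div_le_one_div hm)
  have := h3.trans (Nat.one_div_le_one_div hn)
  linarith

end IteratedLimits

end HerzArens

end

/-! ### Equivalence of the three conditions -/

theorem theorem3p5 {G : Type*} [Group G] [Countable G] (hG : HerzArens.IsAmenable G)
    (p : ℝ) [Fact (1 < p)] :
    List.TFAE [
      HerzArens.ArensRegular (HerzArens.HerzAlgebra G p),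
      ∀ (f g : ℕ → HerzArens.HerzAlgebra G p)
        (φ : ℕ → StrongDual ℂ (HerzArens.HerzAlgebra G p)),
        (∀ n, ‖f n‖ ≤ 1) → (∀ m, ‖g m‖ ≤ 1) → (∀ k, φ k ∈ HerzArens.Zp G p) →
        ∀ (c : ℕ → ℕ → ℂ) (r s : ℕ → ℂ) (a b : ℂ),
          (∀ n m, Tendsto (fun k => φ k (f n * g m)) atTop (𝓝 (c n m))) →
          (∀ n, Tendsto (fun m => c n m) atTop (𝓝 (r n))) → Tendsto r atTop (𝓝 a) →
          (∀ m, Tendsto (fun n => c n m) atTop (𝓝 (s m))) → Tendsto s atTop (𝓝 b) →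
          a = b,
      ∀ (f g : ℕ → HerzArens.HerzAlgebra G p)
        (φ : ℕ → StrongDual ℂ (HerzArens.HerzAlgebra G p)),
        (∀ n, ‖f n‖ ≤ 1) → (∀ m, ‖g m‖ ≤ 1) → (∀ k, φ k ∈ HerzArens.Zp G p) →
        (closure {z : ℂ | ∃ k n m : ℕ, k > n ∧ n > m ∧ z = φ k (f n * g m)} ∩
          closure {z : ℂ | ∃ k n m : ℕ, k > m ∧ m > n ∧ z = φ k (f n * g m)}).Nonempty] := by
  let U : Ultrafilter ℕ := hyperfilter ℕ
  have hU : (U : Filter ℕ) ≤ atTop := Nat.hyperfilter_le_atTop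
  tfae_have 1 → 2 := by
    intro hA f g φ hf hg hφ c r s a b hc hr ha hs hb
    obtain ⟨c', r', s', a', hc', hr', ha', hs', hb'⟩ :=
      hA.exists_iterated_limit U hf hg fun k => HerzArens.norm_le_one_of_mem_Yp (hφ k).2
    have ec : c' = c := funext₂ fun n m => tendsto_nhds_unique (hc' n m) ((hc n m).mono_left hU)
    subst ec
    have er : r' = r := funext fun n => tendsto_nhds_unique (hr' n) ((hr n).mono_left hU)
    have es : s' = s := funext fun n => tendsto_nhds_unique (hs' n) ((hs n).mono_left hU)
    subst er es
    exact (tendsto_nhds_unique (ha.mono_left hU) ha').trans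
      (tendsto_nhds_unique hb' (hb.mono_left hU))
  tfae_have 1 → 3 := by
    intro hA f g φ hf hg hφ
    obtain ⟨c, r, s, a, hc, hr, ha, hs, hb⟩ :=
      hA.exists_iterated_limit U hf hg fun k => HerzArens.norm_le_one_of_mem_Yp (hφ k).2
    -- The order `k > n > m` belongs to the limit taken over `n` before `m`, so the roles of `n` and
    -- `m` are exchanged in the first membership.
    exact ⟨a, HerzArens.mem_closure_of_iterated_limit hU (fun m n => hc n m) hs hb
        fun m n k hmn hnk => ⟨k, n, m, hnk, hmn, rfl⟩,
      HerzArens.mem_closure_of_iterated_limit hU hc hr ha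
        fun n m k hnm hmk => ⟨k, n, m, hmk, hnm, rfl⟩⟩
  tfae_have 2 → 1 := by
    refine fun h => HerzArens.arensRegular_of_norm_le_one fun Ψ Φ φ hΨ hΦ hφ => ?_
    obtain ⟨f, g, φ', r, s, hf, hg, hZ, happ, hr, hs, hfr, hgs⟩ :=
      HerzArens.exists_seq_approx_arensProducts hG hΨ hΦ hφ
    exact h f g φ' hf hg hZ (fun n m => φ (f n * g m)) r s _ _
      (fun n m => HerzArens.tendsto_of_norm_sub_le_one_div (N := max n m) fun k hk =>
        happ k n m ((le_max_left _ _).trans_lt hk) ((le_max_right _ _).trans_lt hk))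
      (fun n => HerzArens.tendsto_of_norm_sub_le_one_div (hfr n))
      (HerzArens.tendsto_of_norm_sub_le_one_div (N := 0) fun n _ => hr n)
      (fun m => HerzArens.tendsto_of_norm_sub_le_one_div fun n hn => hgs n m hn)
      (HerzArens.tendsto_of_norm_sub_le_one_div (N := 0) fun n _ => hs n)
  tfae_have 3 → 1 := by
    refine fun h => HerzArens.arensRegular_of_norm_le_one fun Ψ Φ φ hΨ hΦ hφ => ?_
    obtain ⟨f, g, φ', r, s, hf, hg, hZ, happ, hr, hs, hfr, hgs⟩ :=
      HerzArens.exists_seq_approx_arensProducts hG hΨ hΦ hφ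
    have hN : ∀ N : ℕ, ‖HerzArens.firstArensProduct _ Ψ Φ φ -
        HerzArens.secondArensProduct _ Ψ Φ φ‖ ≤ 6 * (1 / ((N : ℝ) + 1)) := fun N => by
      -- Shifting all indices by `N` makes each of three approximation errors at most `1 / (N + 1)`.
      -- Both closures then lie in balls of radius `3 / (N + 1)` about the respective Arens values,
      -- and a common point gives the factor `6`.
      obtain ⟨z, hz₂, hz₁⟩ := h (fun n => f (n + N)) (fun n => g (n + N)) (fun n => φ' (n + N))
        (fun n => hf _) (fun n => hg _) fun n => hZ _
      have hb : z ∈ Metric.closedBall (HerzArens.secondArensProduct _ Ψ Φ φ)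
          (3 * (1 / ((N : ℝ) + 1))) := by
        refine closure_minimal ?_ Metric.isClosed_closedBall hz₂
        rintro _ ⟨k, n, m, hkn, hnm, rfl⟩
        rw [mem_closedBall_iff_norm]
        exact HerzArens.norm_sub_le_of_three (Nat.le_add_left N k) (Nat.le_add_left N n)
          (Nat.le_add_left N m) (happ _ _ _ (by lia) (by lia)) (hgs _ _ (by lia)) (hs _)
      have ha : z ∈ Metric.closedBall (HerzArens.firstArensProduct _ Ψ Φ φ)
          (3 * (1 / ((N : ℝ) + 1))) := by
        refine closure_minimal ?_ Metric.isClosed_closedBall hz₁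
        rintro _ ⟨k, n, m, hkm, hmn, rfl⟩
        rw [mem_closedBall_iff_norm]
        exact HerzArens.norm_sub_le_of_three (Nat.le_add_left N k) (Nat.le_add_left N m)
          (Nat.le_add_left N n) (happ _ _ _ (by lia) (by lia)) (hfr _ _ (by lia)) (hr _)
      rw [← dist_eq_norm]
      refine (dist_triangle_left _ _ z).trans ?_
      rw [Metric.mem_closedBall] at ha hb
      linarith
    refine eq_of_norm_sub_le_zero (ge_of_tendsto' (x := atTop) ?_ hN)
    simpa using (tendsto_one_div_add_atTop_nhds_zero_nat (𝕜 := ℝ)).const_mul 6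
  tfae_finish
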